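/- Let $I_0=[0,1)$. For a dyadic interval $I\subseteq I_0$ let $I_-$ and $I_+$ be its left and right halves and let $h_I=|I|^{-1/2}(\chi_{I_+}-\chi_{I_-})$ be its $L^2$-normalized Haar function. For a Banach space $X$, the dyadic Hilbert transform $\mathcal S_0$ is the linear operator on $X$-valued functions on $I_0$ determined by $\chi_{I_0}\mapsto 0$, $h_{I_0}\mapsto 0$ and $h_{I_\pm}\mapsto \pm h_{I_\mp}$ for every dyadic $I\subseteq I_0$; that is, with $(f,h_J)=\int_{I_0} f h_J\,dx\in X$, $$\mathcal S_0 f=\sum_{k\ge 0}\ \sum_{|I|=2^{-k}}\Big((f,h_{I_+})\,h_{I_-}-(f,h_{I_-})\,h_{I_+}\Big),$$ where the outer sum converges in $L^p(I_0;X)$. Let $\mathcal H$ be the periodic Hilbert transform on the circle $\mathbb T=\mathbb R/2\pi\mathbb Z$, defined on $X$-valued trigonometric polynomials as the Fourier multiplier with symbol $-i\,\mathrm{sgn}(n)$ (so constants are mapped to $0$, $\cos(nt)$ to $\sin(nt)$ and $\sin(nt)$ to $-\cos(nt)$ for $n\ge1$), and extended by density to $L^p(\mathbb T;X)$. An operator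 norm is understood to be $+\infty$ if the operator is not bounded on $L^p$. There is an absolute constant $C<\infty$ such that for every Banach space $X$ and every $1<p<\infty$ $$\|\mathcal S_0\|_{L^p(I_0;X)\to L^p(I_0;X)}\le C\,\|\mathcal H\|_{L^p(\mathbb T;X)\to L^p(\mathbb T;X)}.$$ In particular, if $\mathcal H$ is bounded on $L^p(\mathbb T;X)$, then $\mathcal S_0$ is defined and bounded on all of $L^p(I_0;X)$. -/

import Mathlib

open MeasureTheory Filter Topology
open scoped ENNReal NNReal

noncomputable section

namespace DyadicHilbert

/-- Lebesgue measure on the unit interval `I₀ = [0, 1)`. -/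
def unitMeasure : Measure ℝ := volume.restrict (Set.Ico 0 1)

/-- Lebesgue measure on one period `(-π, π]` of the circle `𝕋 = ℝ / 2πℤ`. -/
def circleMeasure : Measure ℝ := volume.restrict (Set.Ioc (-Real.pi) Real.pi)

/-- The dyadic interval `[j 2⁻ᵏ, (j + 1) 2⁻ᵏ)`; it lies in `I₀` when `j < 2 ^ k`. Its left half
`I₋` is `dyadicInterval (k + 1) (2 * j)`, its right half `I₊` is
`dyadicInterval (k + 1) (2 * j + 1)`. -/
def dyadicInterval (k j : ℕ) : Set ℝ :=
  Set.Ico ((j : ℝ) / 2 ^ k) (((j : ℝ) + 1) / 2 ^ k)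

/-- The `L²`-normalized Haar function `h_I = |I|^(-1/2) (χ_{I₊} - χ_{I₋})` of
`I = dyadicInterval k j`. -/
def haar (k j : ℕ) (x : ℝ) : ℝ :=
  Real.sqrt (2 ^ k) *
    ((dyadicInterval (k + 1) (2 * j + 1)).indicator (fun _ => (1 : ℝ)) x -
      (dyadicInterval (k + 1) (2 * j)).indicator (fun _ => (1 : ℝ)) x)

variable {X : Type*} [NormedAddCommGroup X] [NormedSpace ℝ X]

/-- The vector-valued Haar coefficient `(f, h_I) ∈ X`, for `I = dyadicInterval k j`. -/
def haarCoeff (f : ℝ → X) (k j : ℕ) : X :=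
  ∫ x, haar k j x • f x ∂unitMeasure

/-- The image under `h_{I_±} ↦ ± h_{I_∓}`, `h_{I₀} ↦ 0`, `χ_{I₀} ↦ 0` of the truncation of the
Haar expansion of `f` to the mean, `h_{I₀}` and the `h_{I_±}` with `|I| > 2⁻ᴺ`. -/
def shiftPartial (f : ℝ → X) (N : ℕ) (x : ℝ) : X :=
  ∑ k ∈ Finset.range N, ∑ j ∈ Finset.range (2 ^ k),
    (haar (k + 1) (2 * j) x • haarCoeff f (k + 1) (2 * j + 1) -
      haar (k + 1) (2 * j + 1) x • haarCoeff f (k + 1) (2 * j))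

/-- `g = S₀ f` in `L^p(I₀; X)`: the expansion defining `S₀ f` converges to `g` in `L^p`. -/
def IsShift (p : ℝ≥0∞) (f g : ℝ → X) : Prop :=
  Tendsto (fun N : ℕ => eLpNorm (fun x => shiftPartial f N x - g x) p unitMeasure) atTop (𝓝 0)

variable (X) in
/-- The operator norm of `S₀ : L^p(I₀; X) → L^p(I₀; X)`; it is `∞` if `S₀` is not a bounded,
everywhere defined operator. -/
def shiftNorm (p : ℝ≥0∞) : ℝ≥0∞ :=
  sInf {K : ℝ≥0∞ | ∀ f : ℝ → X, MemLp f p unitMeasure →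
    ∃ g : ℝ → X, MemLp g p unitMeasure ∧ IsShift p f g ∧
      eLpNorm g p unitMeasure ≤ K * eLpNorm f p unitMeasure}

/-- The `X`-valued trigonometric polynomial `c + ∑_{n = 1}^N (cos (n t) a_n + sin (n t) b_n)`
(the coefficients `a_n`, `b_n` are indexed from `0`). -/
def trigPoly (N : ℕ) (c : X) (a b : ℕ → X) (t : ℝ) : X :=
  c + ∑ n ∈ Finset.range N,
    (Real.cos (((n : ℝ) + 1) * t) • a n + Real.sin (((n : ℝ) + 1) * t) • b n)

/-- The periodic Hilbert transform of `trigPoly N c a b`: the Fourier multiplier `-i sgn n`, that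
is, constants go to `0`, `cos (n t)` goes to `sin (n t)` and `sin (n t)` to `- cos (n t)`. -/
def hilbertTrigPoly (N : ℕ) (a b : ℕ → X) (t : ℝ) : X :=
  ∑ n ∈ Finset.range N,
    (Real.sin (((n : ℝ) + 1) * t) • a n - Real.cos (((n : ℝ) + 1) * t) • b n)

variable (X) in
/-- The operator norm on `L^p(𝕋; X)`, `p < ∞`, of the periodic Hilbert transform, which is densely
defined on the trigonometric polynomials; it is `∞` if there is no bounded extension. -/
def hilbertNorm (p : ℝ≥0∞) : ℝ≥0∞ :=
  sInf {K : ℝ≥0∞ | ∀ (N : ℕ) (c : X) (a b : ℕ → X),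
    eLpNorm (hilbertTrigPoly N a b) p circleMeasure ≤
      K * eLpNorm (trigPoly N c a b) p circleMeasure}

end DyadicHilbert

end

/-!
The dyadic Hilbert transform splits into its levels of even and of odd order, and each half is, up
to an absolute constant, of the form `E ∘ H ∘ J` with `H` the periodic Hilbert transform and `J`,
`E` contractions of `L^p`. This gives a bound linear in the norm of `H`.

Describe a point of the unit interval by its signs `ε₁, ε₂, …` (left or right at each dyadic step).
In terms of two consecutive signs `ε, δ`, with coefficients depending on the earlier signs, the
operator maps `δ ↦ -ε δ` and `ε δ ↦ δ`. The levels of one parity involve disjoint pairs of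
consecutive signs. Encode such a pair by one point `θ` of the circle, through
`δ = sign (sin θ)` and `ε δ = sign (cos θ)`. By symmetry, the averages of the Hilbert transforms of
`sign (sin θ)`, `sign (cos θ)` and `sign (sin θ) sign (cos θ)` over the four quadrants are
`-b ε δ`, `b δ` and `0` for a constant `b`, which is positive because the square waves are close to
`sin` and `cos` (`circleMean_sinWave_mul_im_ge`). So within one pair the Hilbert transform, followed
by averaging over quadrants, is `b` times the dyadic one; functions of `ε` alone are annihilated,
so that the levels of the other parity do not interfere.

Many pairs are encoded at once by taking `θ = L^M t` for the `M`-th pair, with `L` large. For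
trigonometric polynomials in place of the indicators of the quadrants (`QuadrantKernel`), the
encodings are exactly independent (`integral_mul_dilate`), and the Hilbert transform acts only on
the last pair that is present, because a factor of low degree commutes with it on functions of
high frequency (`QuadrantKernel.completion_mem_modes`). Here the Hilbert transform is handled
through analytic completions: it maps `Re g` to `Im g` if `g` has positive frequencies only.
`J` and `E` are the interpolation by and the averages against the resulting positive weights,
hence contractions by Jensen's inequality (`QuadrantKernel.lintegral_sum_weight_le`,
`QuadrantKernel.sum_integral_weight_le`). The kernels are built from odd polynomials converging to
the sign function on `[-1, 1]`; in the limit `E ∘ H ∘ J` becomes the dyadic operator on the averages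
over dyadic intervals (`sum_digitShift_le`). Finally the partial sums of the expansion are uniformly
bounded (`eLpNorm_shiftPartial_le`) and eventually constant on the dense set of dyadic step
functions, so they converge in `L^p`.
-/

namespace DyadicHilbert

open scoped ComplexConjugate

/-! ### Trigonometric polynomials on the circle -/

/-- The normalized Lebesgue measure on one period of the circle. -/
noncomputable def circleProb : Measure ℝ := (ENNReal.ofReal (2 * Real.pi))⁻¹ • circleMeasure

instance : IsProbabilityMeasure circleProb := by
  have h : (0 : ℝ) < 2 * Real.pi := by positivity
  refine ⟨?_⟩
  rw [circleProb, circleMeasure, Measure.smul_apply, Measure.restrict_apply_univ, Real.volume_Ioc,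
    show Real.pi - -Real.pi = 2 * Real.pi by ring, smul_eq_mul]
  exact ENNReal.inv_mul_cancel (by simpa using h) ENNReal.ofReal_ne_top

theorem integrable_circleProb_of_continuous {E : Type*} [NormedAddCommGroup E] {f : ℝ → E}
    (hf : Continuous f) : Integrable f circleProb := by
  have h : (0 : ℝ) < 2 * Real.pi := by positivity
  refine Integrable.smul_measure ?_ (ENNReal.inv_ne_top.2 (by simpa using h))
  exact hf.integrableOn_Ioc

/-- The exponential `t ↦ e^{int}`. -/
noncomputable def expMode (n : ℤ) (t : ℝ) : ℂ := Complex.exp (((n * t : ℝ) : ℂ) * Complex.I)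

theorem expMode_re (n : ℤ) (t : ℝ) : (expMode n t).re = Real.cos (n * t) :=
  Complex.exp_ofReal_mul_I_re _

theorem expMode_im (n : ℤ) (t : ℝ) : (expMode n t).im = Real.sin (n * t) :=
  Complex.exp_ofReal_mul_I_im _

theorem expMode_mul (m n : ℤ) (t : ℝ) : expMode m t * expMode n t = expMode (m + n) t := by
  rw [expMode, expMode, expMode, ← Complex.exp_add]
  congr 1
  push_cast
  ring

theorem expMode_add (n : ℤ) (t a : ℝ) : expMode n (t + a) = expMode n a * expMode n t := by
  rw [expMode, expMode, expMode, ← Complex.exp_add]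
  congr 1
  push_cast
  ring

theorem expMode_dilate (n : ℤ) (N : ℕ) (t : ℝ) : expMode n (N * t) = expMode (N * n) t := by
  rw [expMode, expMode]
  congr 1
  push_cast
  ring

theorem conj_expMode (n : ℤ) (t : ℝ) : conj (expMode n t) = expMode (-n) t := by
  apply Complex.ext
  · simp [expMode_re]
  · simp [expMode_im]

@[fun_prop]
theorem continuous_expMode (n : ℤ) : Continuous (expMode n) := by
  unfold expMode
  fun_prop

theorem expMode_zero (t : ℝ) : expMode 0 t = 1 := by simp [expMode]

theorem integral_expMode {n : ℤ} (hn : n ≠ 0) : ∫ t, expMode n t ∂circleProb = 0 := by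
  rw [circleProb, integral_smul_measure, circleMeasure,
    ← intervalIntegral.integral_of_le (by linarith [Real.pi_pos])]
  have h1 : ∀ t : ℝ, expMode n t = Complex.exp ((n * Complex.I) * t) := fun t => by
    rw [expMode]
    congr 1
    push_cast
    ring
  have hc : (n * Complex.I : ℂ) ≠ 0 := by simp [hn]
  simp_rw [h1]
  rw [integral_exp_mul_complex hc]
  have h2 : Complex.exp (n * Complex.I * (Real.pi : ℝ)) =
      Complex.exp (n * Complex.I * ((-Real.pi : ℝ) : ℂ)) := by
    rw [Complex.exp_eq_exp_iff_exists_int]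
    exact ⟨n, by push_cast; ring⟩
  simp [h2]

/-- The trigonometric polynomials with frequencies in `s`. -/
noncomputable def modes (s : Set ℤ) : Submodule ℂ (ℝ → ℂ) := Submodule.span ℂ (expMode '' s)

theorem expMode_mem_modes {s : Set ℤ} {n : ℤ} (hn : n ∈ s) : expMode n ∈ modes s :=
  Submodule.subset_span ⟨n, hn, rfl⟩

theorem modes_mono {s t : Set ℤ} (h : s ⊆ t) : modes s ≤ modes t :=
  Submodule.span_mono (Set.image_mono h)

/-- Induction on trigonometric polynomials. -/
theorem modes_induction {s : Set ℤ} {P : (ℝ → ℂ) → Prop} (hexp : ∀ n ∈ s, P (expMode n))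
    (hzero : P 0) (hadd : ∀ f g, f ∈ modes s → g ∈ modes s → P f → P g → P (f + g))
    (hsmul : ∀ (c : ℂ) f, f ∈ modes s → P f → P (c • f)) {f : ℝ → ℂ} (hf : f ∈ modes s) : P f := by
  refine Submodule.span_induction (p := fun f _ => P f) ?_ hzero
    (fun f g hf hg => hadd f g hf hg) (fun c f hf => hsmul c f hf) hf
  rintro _ ⟨n, hn, rfl⟩
  exact hexp n hn

theorem continuous_of_mem_modes {s : Set ℤ} {f : ℝ → ℂ} (hf : f ∈ modes s) : Continuous f := by
  refine modes_induction (fun n _ => continuous_expMode n) continuous_const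
    (fun f g _ _ hf hg => hf.add hg) (fun c f _ hf => hf.const_smul c) hf

theorem integrable_of_mem_modes {s : Set ℤ} {f : ℝ → ℂ} (hf : f ∈ modes s) :
    Integrable f circleProb :=
  integrable_circleProb_of_continuous (continuous_of_mem_modes hf)

theorem one_mem_modes {s : Set ℤ} (hs : 0 ∈ s) : (1 : ℝ → ℂ) ∈ modes s := by
  have : (1 : ℝ → ℂ) = expMode 0 := funext fun t => (expMode_zero t).symm
  rw [this]
  exact expMode_mem_modes hs

theorem mul_mem_modes {s t r : Set ℤ} (h : ∀ m ∈ s, ∀ n ∈ t, m + n ∈ r) {f g : ℝ → ℂ}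
    (hf : f ∈ modes s) (hg : g ∈ modes t) : f * g ∈ modes r := by
  refine modes_induction (P := fun f => f * g ∈ modes r) (fun m hm => ?_) (by simp)
    (fun f f' _ _ hf hf' => by rw [add_mul]; exact add_mem hf hf')
    (fun c f _ hf => by rw [smul_mul_assoc]; exact Submodule.smul_mem _ _ hf) hf
  refine modes_induction (P := fun g => expMode m * g ∈ modes r) (fun n hn => ?_) (by simp)
    (fun f f' _ _ hf hf' => by rw [mul_add]; exact add_mem hf hf')
    (fun c f _ hf => by rw [mul_smul_comm]; exact Submodule.smul_mem _ _ hf) hg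
  have : expMode m * expMode n = expMode (m + n) := funext fun t => expMode_mul m n t
  rw [this]
  exact expMode_mem_modes (h m hm n hn)

theorem dilate_mem_modes {s r : Set ℤ} {N : ℕ} (h : ∀ n ∈ s, (N : ℤ) * n ∈ r) {f : ℝ → ℂ}
    (hf : f ∈ modes s) : (fun t => f (N * t)) ∈ modes r := by
  refine modes_induction (P := fun f => (fun t => f (N * t)) ∈ modes r) (fun n hn => ?_)
    (zero_mem _) (fun f f' _ _ hf hf' => add_mem hf hf')
    (fun c f _ hf => Submodule.smul_mem _ c hf) hf
  simp_rw [expMode_dilate]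
  exact expMode_mem_modes (h n hn)

theorem translate_mem_modes {s : Set ℤ} (a : ℝ) {f : ℝ → ℂ}
    (hf : f ∈ modes s) : (fun t => f (t + a)) ∈ modes s := by
  refine modes_induction (P := fun f => (fun t => f (t + a)) ∈ modes s) (fun n hn => ?_)
    (zero_mem _) (fun f f' _ _ hf hf' => add_mem hf hf')
    (fun c f _ hf => Submodule.smul_mem _ c hf) hf
  simp_rw [expMode_add]
  exact Submodule.smul_mem _ (expMode n a) (expMode_mem_modes hn)

theorem conj_mem_modes {s r : Set ℤ} (h : ∀ n ∈ s, -n ∈ r) {f : ℝ → ℂ} (hf : f ∈ modes s) :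
    (fun t => conj (f t)) ∈ modes r := by
  refine modes_induction (P := fun f => (fun t => conj (f t)) ∈ modes r) (fun n hn => ?_)
    (by simp only [Pi.zero_apply, map_zero]; exact zero_mem _) (fun f f' _ _ hf hf' => ?_)
    (fun c f _ hf => ?_) hf
  · simp_rw [conj_expMode]
    exact expMode_mem_modes (h n hn)
  · simp only [Pi.add_apply, map_add]
    exact add_mem hf hf'
  · simp only [Pi.smul_apply, smul_eq_mul, map_mul]
    exact Submodule.smul_mem _ (conj c) hf

theorem integral_eq_zero_of_mem_modes {s : Set ℤ} (hs : 0 ∉ s) {f : ℝ → ℂ} (hf : f ∈ modes s) :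
    ∫ t, f t ∂circleProb = 0 := by
  refine modes_induction (P := fun f => ∫ t, f t ∂circleProb = 0)
    (fun n hn => integral_expMode (fun h => hs (h ▸ hn))) (by simp) (fun f g hf hg h1 h2 => ?_)
    (fun c f _ hf => ?_) hf
  · simp only [Pi.add_apply]
    rw [integral_add (integrable_of_mem_modes hf) (integrable_of_mem_modes hg), h1, h2, add_zero]
  · simp only [Pi.smul_apply]
    rw [integral_smul, hf, smul_zero]

theorem integral_translate_of_mem_modes {s : Set ℤ} (a : ℝ) {f : ℝ → ℂ} (hf : f ∈ modes s) :
    ∫ t, f (t + a) ∂circleProb = ∫ t, f t ∂circleProb := by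
  refine modes_induction (P := fun f => ∫ t, f (t + a) ∂circleProb = ∫ t, f t ∂circleProb)
    (fun n hn => ?_) (by simp) (fun f g hf hg h1 h2 => ?_) (fun c f _ hf => ?_) hf
  · simp_rw [expMode_add]
    rw [integral_const_mul]
    by_cases hn : n = 0
    · simp [hn, expMode_zero]
    · simp [integral_expMode hn]
  · simp only [Pi.add_apply]
    rw [integral_add (integrable_of_mem_modes hf) (integrable_of_mem_modes hg), ← h1, ← h2,
      integral_add (integrable_of_mem_modes (translate_mem_modes a hf))
        (integrable_of_mem_modes (translate_mem_modes a hg))]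
  · simp only [Pi.smul_apply]
    rw [integral_smul, hf, integral_smul]

/-- A trigonometric polynomial of degree below `N` and a function of `N t` are uncorrelated. -/
theorem integral_mul_dilate {N : ℕ} {f g : ℝ → ℂ} (hf : f ∈ modes {n | |n| < (N : ℤ)})
    (hg : g ∈ modes Set.univ) :
    ∫ t, f t * g (N * t) ∂circleProb =
      (∫ t, f t ∂circleProb) * ∫ t, g t ∂circleProb := by
  have hd : ∀ {g}, g ∈ modes Set.univ → (fun t => g (N * t)) ∈ modes Set.univ := fun hg =>
    dilate_mem_modes (fun _ _ => Set.mem_univ _) hg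
  have hm : ∀ {f g : ℝ → ℂ}, f ∈ modes {n | |n| < (N : ℤ)} → g ∈ modes Set.univ →
      Integrable (fun t => f t * g (N * t)) circleProb := fun hf hg =>
    integrable_of_mem_modes (mul_mem_modes (r := Set.univ) (fun _ _ _ _ => Set.mem_univ _)
      hf (hd hg))
  refine modes_induction (P := fun f => ∫ t, f t * g (N * t) ∂circleProb =
      (∫ t, f t ∂circleProb) * ∫ t, g t ∂circleProb) (fun m hm' => ?_) (by simp)
    (fun f f' hf hf' h1 h2 => ?_) (fun c f _ hf => ?_) hf
  · have hmem : expMode m ∈ modes {n | |n| < (N : ℤ)} := expMode_mem_modes hm'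
    refine modes_induction (P := fun g => ∫ t, expMode m t * g (N * t) ∂circleProb =
      (∫ t, expMode m t ∂circleProb) * ∫ t, g t ∂circleProb) (fun n _ => ?_) (by simp)
      (fun g g' hg hg' h1 h2 => ?_) (fun c g _ hg => ?_) hg
    · simp_rw [expMode_dilate, expMode_mul]
      by_cases h0 : m = 0
      · subst h0
        have hN : N ≠ 0 := by
          rintro rfl
          simp at hm'
        by_cases hn : n = 0
        · simp [hn, expMode_zero]
        · rw [integral_expMode hn, integral_expMode (by simp [hn, hN]), mul_zero]
      · rw [integral_expMode h0, zero_mul]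
        refine integral_expMode fun h => h0 (Int.eq_zero_of_abs_lt_dvd (m := N) ⟨-n, ?_⟩ hm')
        linarith
    · simp only [Pi.add_apply, mul_add]
      rw [integral_add (hm hmem hg) (hm hmem hg'), h1, h2,
        integral_add (integrable_of_mem_modes hg) (integrable_of_mem_modes hg'), mul_add]
    · simp only [Pi.smul_apply, mul_smul_comm]
      rw [integral_smul, hg, integral_smul, mul_smul_comm]
  · simp only [Pi.add_apply, add_mul]
    rw [integral_add (hm hf hg) (hm hf' hg), h1, h2,
      integral_add (integrable_of_mem_modes hf) (integrable_of_mem_modes hf'), add_mul]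
  · simp only [Pi.smul_apply, smul_mul_assoc]
    rw [integral_smul, hf, integral_smul, smul_mul_assoc]

theorem exists_degree_bound {s : Set ℤ} {f : ℝ → ℂ} (hf : f ∈ modes s) :
    ∃ R : ℕ, f ∈ modes (s ∩ {n | |n| ≤ (R : ℤ)}) := by
  refine modes_induction (P := fun f => ∃ R : ℕ, f ∈ modes (s ∩ {n | |n| ≤ (R : ℤ)}))
    (fun n hn => ⟨n.natAbs, expMode_mem_modes ⟨hn, by simp⟩⟩) ⟨0, zero_mem _⟩
    ?_ (fun c f _ ⟨R, hR⟩ => ⟨R, Submodule.smul_mem _ c hR⟩) hf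
  rintro f g - - ⟨R, hR⟩ ⟨R', hR'⟩
  refine ⟨max R R', add_mem (modes_mono ?_ hR) (modes_mono ?_ hR')⟩
  · rintro n ⟨h1, h2⟩
    refine ⟨h1, ?_⟩
    simp only [Set.mem_ofPred_eq] at h2 ⊢
    push_cast
    exact h2.trans (le_max_left _ _)
  · rintro n ⟨h1, h2⟩
    refine ⟨h1, ?_⟩
    simp only [Set.mem_ofPred_eq] at h2 ⊢
    push_cast
    exact h2.trans (le_max_right _ _)

/-- The analytic trigonometric polynomials without constant term. If `g` is one of them, the
Hilbert transform maps `Re g` to `Im g`. -/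
noncomputable abbrev analyticModes : Submodule ℂ (ℝ → ℂ) := modes {n | 1 ≤ n}

theorem exists_add_conj_of_mem_modes {f : ℝ → ℂ} (hf : f ∈ modes Set.univ) :
    ∃ c : ℂ, ∃ g ∈ analyticModes, ∃ h ∈ analyticModes, ∀ t, f t = c + g t + conj (h t) := by
  refine modes_induction (P := fun f => ∃ c : ℂ, ∃ g ∈ analyticModes, ∃ h ∈ analyticModes,
    ∀ t, f t = c + g t + conj (h t)) (fun n _ => ?_)
    ⟨0, 0, zero_mem _, 0, zero_mem _, by simp⟩ ?_ ?_ hf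
  · rcases lt_trichotomy n 0 with hn | hn | hn
    · refine ⟨0, 0, zero_mem _, expMode (-n), expMode_mem_modes ?_, fun t => ?_⟩
      · simp only [Set.mem_ofPred_eq]
        omega
      · simp [conj_expMode]
    · exact ⟨1, 0, zero_mem _, 0, zero_mem _, fun t => by simp [hn, expMode_zero]⟩
    · exact ⟨0, expMode n, expMode_mem_modes hn, 0, zero_mem _, fun t => by simp⟩
  · rintro f f' - - ⟨c, g, hg, h, hh, e⟩ ⟨c', g', hg', h', hh', e'⟩
    refine ⟨c + c', g + g', add_mem hg hg', h + h', add_mem hh hh', fun t => ?_⟩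
    simp only [Pi.add_apply, e, e', map_add]
    ring
  · rintro a f - ⟨c, g, hg, h, hh, e⟩
    refine ⟨a * c, a • g, Submodule.smul_mem _ _ hg, conj a • h, Submodule.smul_mem _ _ hh,
      fun t => ?_⟩
    simp only [Pi.smul_apply, smul_eq_mul, e, map_mul, Complex.conj_conj]
    ring

theorem integral_re_analyticModes {g : ℝ → ℂ} (hg : g ∈ analyticModes) :
    ∫ t, (g t).re ∂circleProb = 0 := by
  have h := integral_eq_zero_of_mem_modes (by simp) hg
  have h2 := integral_re (integrable_of_mem_modes hg)
  simp only [RCLike.re_eq_complex_re] at h2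
  rw [h2, h, Complex.zero_re]

theorem integral_im_analyticModes {g : ℝ → ℂ} (hg : g ∈ analyticModes) :
    ∫ t, (g t).im ∂circleProb = 0 := by
  have h := integral_eq_zero_of_mem_modes (by simp) hg
  have h2 := integral_im (integrable_of_mem_modes hg)
  simp only [RCLike.im_eq_complex_im] at h2
  rw [h2, h, Complex.zero_im]

/-- A real trigonometric polynomial is its mean plus the real part of an analytic one. -/
theorem exists_analytic_completion {u : ℝ → ℝ} (hu : (fun t => (u t : ℂ)) ∈ modes Set.univ) :
    ∃ g ∈ analyticModes, ∀ t, u t = (∫ x, u x ∂circleProb) + (g t).re := by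
  obtain ⟨c, g, hg, h, hh, e⟩ := exists_add_conj_of_mem_modes hu
  have e' : ∀ t, u t = c.re + ((g + h) t).re := fun t => by
    have := congrArg Complex.re (e t)
    simp only [Complex.ofReal_re, Complex.add_re, Complex.conj_re] at this
    simp only [Pi.add_apply, Complex.add_re, this]
    ring
  have hgh : g + h ∈ analyticModes := add_mem hg hh
  refine ⟨g + h, hgh, fun t => ?_⟩
  have hc : ∫ x, u x ∂circleProb = c.re := by
    simp_rw [e']
    rw [integral_add (integrable_const _)
      (integrable_circleProb_of_continuous (f := fun x => ((g + h) x).re)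
        (Complex.continuous_re.comp (continuous_of_mem_modes hgh))),
      integral_re_analyticModes hgh]
    simp
  rw [hc, e' t]

/-- The Hilbert transform is an antisymmetric isometry of the mean-zero part of `L²`. -/
theorem integral_mul_analyticModes {g h : ℝ → ℂ} (hg : g ∈ analyticModes)
    (hh : h ∈ analyticModes) :
    ∫ t, (g t).re * (h t).re ∂circleProb = ∫ t, (g t).im * (h t).im ∂circleProb ∧
      ∫ t, (g t).re * (h t).im ∂circleProb = -∫ t, (g t).im * (h t).re ∂circleProb := by
  have hgc := continuous_of_mem_modes hg
  have hhc := continuous_of_mem_modes hh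
  have hgh : g * h ∈ analyticModes :=
    mul_mem_modes (fun m hm n hn => by simp only [Set.mem_ofPred_eq] at *; omega) hg hh
  have h1 := integral_re_analyticModes hgh
  have h2 := integral_im_analyticModes hgh
  simp only [Pi.mul_apply, Complex.mul_re, Complex.mul_im] at h1 h2
  rw [integral_sub (integrable_circleProb_of_continuous (by fun_prop))
    (integrable_circleProb_of_continuous (by fun_prop))] at h1
  rw [integral_add (integrable_circleProb_of_continuous (by fun_prop))
    (integrable_circleProb_of_continuous (by fun_prop))] at h2
  constructor <;> linarith

/-! ### Polynomials approximating the sign function, and the quadrant kernels -/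

/-- The iterates of `y ↦ (3 y - y³) / 2`: odd polynomials which map `[-1, 1]` to itself and
converge there to the sign function. -/
noncomputable def signIter : ℕ → ℝ → ℝ
  | 0, x => x
  | n + 1, x => (3 * signIter n x - signIter n x ^ 3) / 2

theorem signIter_neg (n : ℕ) (x : ℝ) : signIter n (-x) = -signIter n x := by
  induction n with
  | zero => rfl
  | succ n ih =>
    rw [signIter, signIter, ih]
    ring

theorem continuous_signIter (n : ℕ) : Continuous (signIter n) := by
  induction n with
  | zero => exact continuous_id
  | succ n ih =>
    simp only [signIter]
    fun_prop

theorem signIter_mem_Icc (n : ℕ) {x : ℝ} (h0 : 0 ≤ x) (h1 : x ≤ 1) :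
    x ≤ signIter n x ∧ signIter n x ≤ 1 := by
  induction n with
  | zero => exact ⟨le_rfl, h1⟩
  | succ n ih =>
    obtain ⟨ih1, ih2⟩ := ih
    have h3 : 0 ≤ signIter n x := h0.trans ih1
    rw [signIter]
    constructor
    · nlinarith [mul_nonneg h3 (sub_nonneg.2 ih2), mul_nonneg (mul_nonneg h3 h3) (sub_nonneg.2 ih2)]
    · nlinarith [mul_nonneg (sq_nonneg (1 - signIter n x)) (by linarith : 0 ≤ 2 + signIter n x)]

theorem signIter_le_succ (n : ℕ) {x : ℝ} (h0 : 0 ≤ x) (h1 : x ≤ 1) :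
    signIter n x ≤ signIter (n + 1) x := by
  obtain ⟨ih1, ih2⟩ := signIter_mem_Icc n h0 h1
  have h3 : 0 ≤ signIter n x := h0.trans ih1
  rw [signIter]
  nlinarith [mul_nonneg h3 (sub_nonneg.2 ih2), mul_nonneg (mul_nonneg h3 h3) (sub_nonneg.2 ih2)]

theorem abs_signIter_le_one (n : ℕ) {x : ℝ} (hx : |x| ≤ 1) : |signIter n x| ≤ 1 := by
  obtain ⟨hx1, hx2⟩ := abs_le.1 hx
  rcases le_total 0 x with h | h
  · obtain ⟨h1, h2⟩ := signIter_mem_Icc n h hx2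
    exact abs_le.2 ⟨by linarith, h2⟩
  · obtain ⟨h1, h2⟩ := signIter_mem_Icc n (neg_nonneg.2 h) (by linarith)
    rw [signIter_neg] at h1 h2
    exact abs_le.2 ⟨by linarith, by linarith⟩

theorem tendsto_signIter_of_pos {x : ℝ} (h0 : 0 < x) (h1 : x ≤ 1) :
    Tendsto (fun n => signIter n x) atTop (𝓝 1) := by
  have key : ∀ n, 1 - signIter n x ≤ (1 - x / 2) ^ n := by
    intro n
    induction n with
    | zero => rw [signIter, pow_zero]; linarith
    | succ n ih =>
      obtain ⟨ih1, ih2⟩ := signIter_mem_Icc n h0.le h1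
      have h3 : 1 - signIter (n + 1) x =
          (1 - signIter n x) * ((1 - signIter n x) * (2 + signIter n x) / 2) := by
        rw [signIter]
        ring
      rw [h3, pow_succ]
      refine mul_le_mul ih ?_ ?_ (pow_nonneg (by linarith) n)
      · nlinarith [sq_nonneg (signIter n x)]
      · exact div_nonneg (mul_nonneg (by linarith) (by linarith)) two_pos.le
  have hlim : Tendsto (fun n : ℕ => 1 - (1 - x / 2) ^ n) atTop (𝓝 (1 - 0)) :=
    (tendsto_pow_atTop_nhds_zero_of_lt_one (by linarith) (by linarith)).const_sub 1
  rw [sub_zero] at hlim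
  exact tendsto_of_tendsto_of_tendsto_of_le_of_le hlim tendsto_const_nhds
    (fun n => by have := key n; simp only; linarith) fun n => (signIter_mem_Icc n h0.le h1).2

theorem tendsto_signIter_sq {x : ℝ} (h0 : x ≠ 0) (h1 : |x| ≤ 1) :
    Tendsto (fun n => signIter n x ^ 2) atTop (𝓝 1) := by
  have h : ∀ y : ℝ, 0 < y → y ≤ 1 → Tendsto (fun n => signIter n y ^ 2) atTop (𝓝 1) :=
    fun y hy hy' => by simpa using (tendsto_signIter_of_pos hy hy').pow 2
  obtain ⟨hx1, hx2⟩ := abs_le.1 h1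
  rcases lt_or_gt_of_ne h0 with hx | hx
  · simpa [signIter_neg] using h (-x) (by linarith) (by linarith)
  · exact h x hx hx2

theorem mul_signIter_succ_ge (n : ℕ) {x : ℝ} (hx : |x| ≤ 1) :
    x * ((3 * x - x ^ 3) / 2) ≤ x * signIter (n + 1) x := by
  have h : ∀ y : ℝ, 0 ≤ y → y ≤ 1 → y * ((3 * y - y ^ 3) / 2) ≤ y * signIter (n + 1) y := by
    intro y hy hy'
    refine mul_le_mul_of_nonneg_left ?_ hy
    have hmono : Monotone fun n => signIter n y := monotone_nat_of_le_succ fun n =>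
      signIter_le_succ n hy hy'
    exact hmono (Nat.le_add_left 1 n)
  obtain ⟨hx1, hx2⟩ := abs_le.1 hx
  rcases le_total 0 x with hx | hx
  · exact h x hx hx2
  · have := h (-x) (by linarith) (by linarith)
    rw [signIter_neg] at this
    nlinarith

theorem ofReal_re_mem_modes {s : Set ℤ} (hs : ∀ n ∈ s, -n ∈ s) {g : ℝ → ℂ} (hg : g ∈ modes s) :
    (fun t => ((g t).re : ℂ)) ∈ modes s := by
  have h2 := Submodule.smul_mem _ (1 / 2 : ℂ) (add_mem hg (conj_mem_modes hs hg))
  have h3 : (fun t => ((g t).re : ℂ)) = (1 / 2 : ℂ) • (g + fun t => conj (g t)) := by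
    ext t
    simp [Complex.add_conj]
  rwa [h3]

theorem ofReal_im_mem_modes {s : Set ℤ} (hs : ∀ n ∈ s, -n ∈ s) {g : ℝ → ℂ} (hg : g ∈ modes s) :
    (fun t => ((g t).im : ℂ)) ∈ modes s := by
  have h := ofReal_re_mem_modes hs (Submodule.smul_mem _ (-Complex.I) hg)
  convert h using 3 with t
  simp

/-- The real trigonometric polynomials. -/
def IsRealTrig (u : ℝ → ℝ) : Prop := (fun t => (u t : ℂ)) ∈ modes Set.univ

namespace IsRealTrig

variable {u v : ℝ → ℝ}

theorem continuous (hu : IsRealTrig u) : Continuous u :=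
  Complex.continuous_re.comp (continuous_of_mem_modes hu)

theorem add (hu : IsRealTrig u) (hv : IsRealTrig v) : IsRealTrig (fun t => u t + v t) := by
  have := add_mem (S := Submodule ℂ (ℝ → ℂ)) hu hv
  simp only [IsRealTrig, Complex.ofReal_add]
  exact this

theorem mul (hu : IsRealTrig u) (hv : IsRealTrig v) : IsRealTrig (fun t => u t * v t) := by
  have := mul_mem_modes (r := Set.univ) (fun _ _ _ _ => Set.mem_univ _) hu hv
  simp only [IsRealTrig, Complex.ofReal_mul]
  exact this

theorem const (c : ℝ) : IsRealTrig (fun _ => c) := by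
  have := Submodule.smul_mem _ (c : ℂ) (one_mem_modes (Set.mem_univ (0 : ℤ)))
  have h : (fun _ : ℝ => (c : ℂ)) = (c : ℂ) • (1 : ℝ → ℂ) := by
    ext t
    simp
  rwa [IsRealTrig, h]

theorem signIter (hu : IsRealTrig u) (n : ℕ) : IsRealTrig (fun t => signIter n (u t)) := by
  induction n with
  | zero => exact hu
  | succ n ih =>
    have h := ((const (3 / 2)).mul ih).add ((const (-1 / 2)).mul (ih.mul (ih.mul ih)))
    convert h using 2 with t
    rw [DyadicHilbert.signIter]
    ring

theorem re {g : ℝ → ℂ} {s : Set ℤ} (hg : g ∈ modes s) : IsRealTrig (fun t => (g t).re) :=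
  ofReal_re_mem_modes (fun _ _ => Set.mem_univ _) (modes_mono (Set.subset_univ _) hg)

theorem im {g : ℝ → ℂ} {s : Set ℤ} (hg : g ∈ modes s) : IsRealTrig (fun t => (g t).im) :=
  ofReal_im_mem_modes (fun _ _ => Set.mem_univ _) (modes_mono (Set.subset_univ _) hg)

theorem integral_translate (hu : IsRealTrig u) (a : ℝ) :
    ∫ t, u (t + a) ∂circleProb = ∫ t, u t ∂circleProb := by
  have := integral_translate_of_mem_modes a hu
  simp only [integral_complex_ofReal] at this
  exact_mod_cast this

theorem integral_eq_zero (hu : IsRealTrig u) (a : ℝ) (h : ∀ t, u (t + a) = -u t) :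
    ∫ t, u t ∂circleProb = 0 := by
  have := hu.integral_translate a
  simp_rw [h] at this
  rw [integral_neg] at this
  linarith

theorem cos : IsRealTrig Real.cos := by
  have := re (expMode_mem_modes (Set.mem_univ (1 : ℤ)))
  simpa [expMode_re] using this

theorem sin : IsRealTrig Real.sin := by
  have := im (expMode_mem_modes (Set.mem_univ (1 : ℤ)))
  simpa [expMode_im] using this

end IsRealTrig

theorem periodic_of_mem_modes {s : Set ℤ} {f : ℝ → ℂ} (hf : f ∈ modes s) (t : ℝ) :
    f (t + 2 * Real.pi) = f t := by
  refine modes_induction (P := fun f => f (t + 2 * Real.pi) = f t) (fun n _ => ?_) rfl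
    (fun f g _ _ h1 h2 => by simp [h1, h2]) (fun c f _ h => by simp [h]) hf
  rw [expMode_add]
  have : expMode n (2 * Real.pi) = 1 := by
    rw [expMode, Complex.exp_eq_one_iff]
    exact ⟨n, by push_cast; ring⟩
  rw [this, one_mul]

theorem integral_circleProb (u : ℝ → ℝ) :
    ∫ t, u t ∂circleProb = (2 * Real.pi)⁻¹ * ∫ t in (-Real.pi)..Real.pi, u t := by
  rw [circleProb, integral_smul_measure, circleMeasure,
    ← intervalIntegral.integral_of_le (by linarith [Real.pi_pos]), ENNReal.toReal_inv,
    ENNReal.toReal_ofReal (by positivity), smul_eq_mul]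

theorem integral_cos_sq_circleProb : ∫ t, Real.cos t ^ 2 ∂circleProb = 1 / 2 := by
  rw [integral_circleProb, integral_cos_sq]
  have := Real.pi_ne_zero
  simp
  field_simp

theorem integral_cos_four_circleProb : ∫ t, Real.cos t ^ 4 ∂circleProb = 3 / 8 := by
  rw [integral_circleProb, integral_cos_pow, integral_cos_sq]
  have := Real.pi_ne_zero
  simp
  field_simp
  norm_num

theorem ae_cos_ne_zero : ∀ᵐ t ∂circleProb, Real.cos t ≠ 0 := by
  have h : {t : ℝ | Real.cos t = 0}.Countable := by
    have : {t : ℝ | Real.cos t = 0} ⊆ Set.range fun k : ℤ => (2 * k + 1) * Real.pi / 2 := by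
      intro t ht
      obtain ⟨k, hk⟩ := Real.cos_eq_zero_iff.1 ht
      exact ⟨k, hk.symm⟩
    exact (Set.countable_range _).mono this
  rw [circleProb, circleMeasure]
  refine Measure.ae_smul_measure (ae_restrict_of_ae ?_) _
  have := h.measure_zero volume
  rw [ae_iff]
  simpa using this

theorem tendsto_integral_signIter_cos_sq :
    Tendsto (fun n => ∫ t, signIter n (Real.cos t) ^ 2 ∂circleProb) atTop (𝓝 1) := by
  have h := tendsto_integral_of_dominated_convergence (μ := circleProb)
    (F := fun n t => signIter n (Real.cos t) ^ 2) (f := fun _ => 1) (fun _ => 1)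
    (fun n => Continuous.aestronglyMeasurable
      (((continuous_signIter n).comp Real.continuous_cos).pow 2)) (integrable_const _)
    (fun n => ae_of_all _ fun t => ?_)
    (ae_cos_ne_zero.mono fun t ht => tendsto_signIter_sq ht (Real.abs_cos_le_one t))
  · simpa using h
  · rw [norm_pow, Real.norm_eq_abs]
    exact pow_le_one₀ (abs_nonneg _) (abs_signIter_le_one n (Real.abs_cos_le_one t))

/-- The mean over the circle as a linear functional on continuous functions. -/
noncomputable def circleMean : C(ℝ, ℝ) →ₗ[ℝ] ℝ where
  toFun u := ∫ t, u t ∂circleProb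
  map_add' u v := integral_add (integrable_circleProb_of_continuous u.continuous)
    (integrable_circleProb_of_continuous v.continuous)
  map_smul' c _ := integral_smul c _

theorem circleMean_apply (u : C(ℝ, ℝ)) : circleMean u = ∫ t, u t ∂circleProb := rfl

theorem circleMean_one : circleMean 1 = 1 := by
  rw [circleMean_apply]
  simp

/-- The sign `ε` of the first step of the two steps in a dyadic tree coded by a base-`4` digit. -/
noncomputable def firstSign (q : ℕ) : ℝ := if q % 4 < 2 then -1 else 1

/-- The sign `δ` of the second step of the two steps in a dyadic tree coded by a base-`4` digit. -/
noncomputable def secondSign (q : ℕ) : ℝ := if q % 2 = 0 then -1 else 1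

/-- The matrix, on functions of two signs `ε, δ`, of the operator which maps `δ ↦ -εδ`,
`εδ ↦ δ`, `1 ↦ 0`, `ε ↦ 0`: the dyadic Hilbert transform within one interval. -/
noncomputable def blockShift (q' q : ℕ) : ℝ :=
  1 / 4 * secondSign q' * secondSign q * (firstSign q - firstSign q')

/-- Trigonometric polynomials `K 0, …, K 3` which nearly are the indicators of the four quadrants
of the circle, together with the analytic completions `G q` of `K q - 1 / 4`. The correlations of
`K` with its Hilbert transform reproduce `blockShift`, up to the factor `b`. The parameter `η`
bounds the distance of the normalized correlations of `K` from the identity matrix, and `R` the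
degrees. -/
structure QuadrantKernel (η : ℝ) where
  K : ℕ → ℝ → ℝ
  G : ℕ → ℝ → ℂ
  R : ℕ
  b : ℝ
  nonneg : ∀ q t, 0 ≤ K q t
  sum_eq_one : ∀ t, ∑ q ∈ Finset.range 4, K q t = 1
  eq_re : ∀ q t, K q t = 1 / 4 + (G q t).re
  mem_modes : ∀ q, G q ∈ modes ({n | 1 ≤ n} ∩ {n | |n| ≤ (R : ℤ)})
  lower : 17 / 64 ≤ b
  shift : ∀ q' q, 4 * ∫ t, K q' t * (G q t).im ∂circleProb = b * blockShift q' q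
  near : ∀ q' < 4, ∀ q < 4,
    |4 * ∫ t, K q' t * K q t ∂circleProb - if q' = q then 1 else 0| ≤ η

section Construction

variable (n : ℕ)

/-- A trigonometric polynomial close to the square wave `sign (cos t)`. -/
noncomputable def cosWave : C(ℝ, ℝ) :=
  ⟨fun t => signIter n (Real.cos t), (continuous_signIter n).comp Real.continuous_cos⟩

/-- A trigonometric polynomial close to the square wave `sign (sin t)`. -/
noncomputable def sinWave : C(ℝ, ℝ) :=
  ⟨fun t => signIter n (Real.sin t), (continuous_signIter n).comp Real.continuous_sin⟩

theorem isRealTrig_cosWave : IsRealTrig (cosWave n) := IsRealTrig.cos.signIter n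

theorem isRealTrig_sinWave : IsRealTrig (sinWave n) := IsRealTrig.sin.signIter n

theorem abs_cosWave_le_one (t : ℝ) : |cosWave n t| ≤ 1 :=
  abs_signIter_le_one n (Real.abs_cos_le_one t)

theorem abs_sinWave_le_one (t : ℝ) : |sinWave n t| ≤ 1 :=
  abs_signIter_le_one n (Real.abs_sin_le_one t)

theorem cosWave_add_pi (t : ℝ) : cosWave n (t + Real.pi) = -cosWave n t := by
  simp [cosWave, signIter_neg]

theorem sinWave_add_pi (t : ℝ) : sinWave n (t + Real.pi) = -sinWave n t := by
  simp [sinWave, signIter_neg]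

theorem cosWave_add_pi_div_two (t : ℝ) : cosWave n (t + Real.pi / 2) = -sinWave n t := by
  simp [cosWave, sinWave, signIter_neg, Real.cos_add_pi_div_two]

theorem sinWave_add_pi_div_two (t : ℝ) : sinWave n (t + Real.pi / 2) = cosWave n t := by
  simp [cosWave, sinWave, Real.sin_add_pi_div_two]

theorem circleMean_eq_zero {u : C(ℝ, ℝ)} (hu : IsRealTrig u) (a : ℝ)
    (h : ∀ t, u (t + a) = -u t) : circleMean u = 0 :=
  hu.integral_eq_zero a h

theorem circleMean_translate {u v : C(ℝ, ℝ)} (hu : IsRealTrig u) (a : ℝ)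
    (h : ∀ t, u (t + a) = v t) : circleMean v = circleMean u := by
  rw [circleMean_apply, circleMean_apply, ← hu.integral_translate a]
  simp_rw [h]

theorem circleMean_nonneg {u : C(ℝ, ℝ)} (h : ∀ t, 0 ≤ u t) : 0 ≤ circleMean u :=
  integral_nonneg h

theorem circleMean_mono {u v : C(ℝ, ℝ)} (h : ∀ t, u t ≤ v t) : circleMean u ≤ circleMean v := by
  have := circleMean_nonneg (u := v - u) fun t => by simpa using h t
  rw [map_sub] at this
  linarith

theorem circleMean_cosWave : circleMean (cosWave n) = 0 :=
  circleMean_eq_zero (isRealTrig_cosWave n) _ (cosWave_add_pi n)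

theorem circleMean_sinWave : circleMean (sinWave n) = 0 :=
  circleMean_eq_zero (isRealTrig_sinWave n) _ (sinWave_add_pi n)

theorem circleMean_sin_mul_cosWave : circleMean (sinWave n * cosWave n) = 0 :=
  circleMean_eq_zero ((isRealTrig_sinWave n).mul (isRealTrig_cosWave n)) (Real.pi / 2) fun t => by
    simp only [ContinuousMap.mul_apply, sinWave_add_pi_div_two, cosWave_add_pi_div_two]
    ring

theorem circleMean_sinWave_sq :
    circleMean (sinWave n * sinWave n) = circleMean (cosWave n * cosWave n) :=
  circleMean_translate ((isRealTrig_cosWave n).mul (isRealTrig_cosWave n)) (Real.pi / 2) fun t => by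
    simp only [ContinuousMap.mul_apply, cosWave_add_pi_div_two]
    ring

/-- The correlation of `cosWave` with `cos` increases with the number of iterations, and `9 / 16` is
its value after one iteration. -/
theorem circleMean_cosWave_mul_cos_ge :
    9 / 16 ≤ circleMean (cosWave (n + 1) * ⟨Real.cos, Real.continuous_cos⟩) := by
  set c : C(ℝ, ℝ) := ⟨Real.cos, Real.continuous_cos⟩ with hc
  have h2 : circleMean (c * c) = 1 / 2 := by
    rw [← integral_cos_sq_circleProb, circleMean_apply]
    congr 1 with t
    exact (sq _).symm
  have h4 : circleMean (c * c * (c * c)) = 3 / 8 := by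
    rw [← integral_cos_four_circleProb, circleMean_apply]
    congr 1 with t
    simp only [hc, ContinuousMap.mul_apply, ContinuousMap.coe_mk]
    ring
  have h : circleMean ((3 / 2 : ℝ) • (c * c) - (1 / 2 : ℝ) • (c * c * (c * c))) ≤
      circleMean (cosWave (n + 1) * c) := by
    refine circleMean_mono fun t => ?_
    have := mul_signIter_succ_ge n (Real.abs_cos_le_one t)
    simp only [hc, cosWave, ContinuousMap.mul_apply, ContinuousMap.coe_mk, ContinuousMap.sub_apply,
      ContinuousMap.smul_apply, smul_eq_mul]
    linarith
  rw [map_sub, map_smul, map_smul, h2, h4] at h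
  norm_num at h
  linarith

/-- The correlation of `sinWave` with the Hilbert transform `Im g` of `cosWave`. Both have the same
norm as `cosWave`, and the same large first Fourier coefficient. -/
theorem circleMean_sinWave_mul_im_ge {g : ℝ → ℂ} (hg : g ∈ analyticModes)
    (hre : ∀ t, cosWave (n + 1) t = (g t).re) {v : C(ℝ, ℝ)} (hv : ∀ t, v t = (g t).im) :
    17 / 64 ≤ circleMean (sinWave (n + 1) * v) := by
  set S := sinWave (n + 1)
  set C := cosWave (n + 1)
  set c : C(ℝ, ℝ) := ⟨Real.cos, Real.continuous_cos⟩ with hc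
  set s : C(ℝ, ℝ) := ⟨Real.sin, Real.continuous_sin⟩ with hs
  set a := circleMean (C * c) with ha
  have ha' : 9 / 16 ≤ a := circleMean_cosWave_mul_cos_ge n
  have hexp : expMode 1 ∈ analyticModes := expMode_mem_modes (by simp)
  have hvv : circleMean (v * v) = circleMean (C * C) := by
    have := (integral_mul_analyticModes hg hg).1
    simp only [circleMean_apply, ContinuousMap.mul_apply, hv, C, hre]
    exact this.symm
  have hvs : circleMean (v * s) = a := by
    have := (integral_mul_analyticModes hg hexp).1
    simp only [expMode_re, expMode_im, Int.cast_one, one_mul] at this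
    simp only [ha, circleMean_apply, ContinuousMap.mul_apply, hv, C, hre]
    exact this.symm
  have hSs : circleMean (S * s) = a :=
    circleMean_translate ((isRealTrig_cosWave (n + 1)).mul IsRealTrig.cos) (Real.pi / 2) fun t => by
      simp only [S, C, hc, hs, ContinuousMap.mul_apply, cosWave_add_pi_div_two,
        Real.cos_add_pi_div_two, ContinuousMap.coe_mk]
      ring
  have hss : circleMean (s * s) = 1 / 2 := by
    have : circleMean (c * c) = 1 / 2 := by
      rw [← integral_cos_sq_circleProb, circleMean_apply]
      congr 1 with t
      exact (sq _).symm
    rw [← this]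
    refine circleMean_translate (IsRealTrig.cos.mul IsRealTrig.cos) (Real.pi / 2) fun t => ?_
    simp only [hc, hs, ContinuousMap.mul_apply, Real.cos_add_pi_div_two, ContinuousMap.coe_mk]
    ring
  have hCC : circleMean (C * C) ≤ 1 := by
    rw [← circleMean_one]
    refine circleMean_mono fun t => ?_
    have := abs_cosWave_le_one (n + 1) t
    have h2 := abs_le.1 this
    simp only [C, ContinuousMap.mul_apply, ContinuousMap.one_apply]
    nlinarith
  have hSS : circleMean (S * S) = circleMean (C * C) := circleMean_sinWave_sq (n + 1)
  -- Both `S` and `v` have the first Fourier component `(2 a) • s`; the square of what remains of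
  -- `S + v` has nonnegative mean.
  have key : 0 ≤ circleMean ((S + v - (4 * a) • s) * (S + v - (4 * a) • s)) :=
    circleMean_nonneg fun t => mul_self_nonneg _
  have hexpand : (S + v - (4 * a) • s) * (S + v - (4 * a) • s) =
      S * S + v * v + (16 * a ^ 2) • (s * s) + (2 : ℝ) • (S * v) - (8 * a) • (S * s)
        - (8 * a) • (v * s) := by
    ext t
    simp only [ContinuousMap.mul_apply, ContinuousMap.add_apply, ContinuousMap.sub_apply,
      ContinuousMap.smul_apply, smul_eq_mul]
    ring
  rw [hexpand] at key
  simp only [map_add, map_sub, map_smul, smul_eq_mul, hSS, hvv, hss, hSs, hvs] at key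
  nlinarith

theorem circleMean_antisymm {g h : ℝ → ℂ} (hg : g ∈ analyticModes) (hh : h ∈ analyticModes)
    {u u' v v' : C(ℝ, ℝ)} (hu : ∀ t, u t = (g t).re) (hu' : ∀ t, u' t = (g t).im)
    (hv : ∀ t, v t = (h t).re) (hv' : ∀ t, v' t = (h t).im) :
    circleMean (u * v') = -circleMean (v * u') := by
  have := (integral_mul_analyticModes hg hh).2
  simp only [circleMean_apply, ContinuousMap.mul_apply, hu, hu', hv, hv']
  rw [this]
  simp_rw [mul_comm]

theorem circleMean_im {g : ℝ → ℂ} (hg : g ∈ analyticModes) {u : C(ℝ, ℝ)}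
    (hu : ∀ t, u t = (g t).im) : circleMean u = 0 := by
  simp only [circleMean_apply, hu]
  exact integral_im_analyticModes hg

end Construction

theorem firstSign_eq (q : ℕ) : firstSign q = 1 ∨ firstSign q = -1 := by
  unfold firstSign
  split_ifs <;> simp

theorem secondSign_eq (q : ℕ) : secondSign q = 1 ∨ secondSign q = -1 := by
  unfold secondSign
  split_ifs <;> simp

theorem sign_values : firstSign 0 = -1 ∧ firstSign 1 = -1 ∧ firstSign 2 = 1 ∧ firstSign 3 = 1 ∧
    secondSign 0 = -1 ∧ secondSign 1 = 1 ∧ secondSign 2 = -1 ∧ secondSign 3 = 1 := by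
  norm_num [firstSign, secondSign]

/-- The sum over the four characters of the two signs is the identity matrix; when the characters
get weights close to `1`, as here, it is so up to `η`. -/
theorem abs_signs_sub_ite_le {ρ σ η : ℝ} (hρ1 : ρ ≤ 1) (hρ2 : 1 - η < ρ) (hσ1 : σ ≤ 1)
    (hσ2 : 2 * ρ - 1 ≤ σ) {q' q : ℕ} (hq' : q' < 4) (hq : q < 4) :
    |1 / 4 * (1 + secondSign q' * secondSign q * ρ +
        firstSign q' * secondSign q' * (firstSign q * secondSign q) * ρ +
        firstSign q' * firstSign q * σ) - if q' = q then 1 else 0| ≤ η := by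
  obtain ⟨v0, v1, v2, v3, w0, w1, w2, w3⟩ := sign_values
  rw [abs_le]
  interval_cases q' <;> interval_cases q <;> simp only [v0, v1, v2, v3, w0, w1, w2, w3] <;>
    norm_num <;> constructor <;> linarith

/-- The kernel `(1 + δ S) (1 + ε δ C) / 4`, with `S` and `C` approximate square waves. All the
correlations of `1`, `S`, `C`, `S C` and of their Hilbert transforms which do not enter the claim
vanish, by antisymmetry or by translations by `π` and `π / 2`. -/
theorem exists_quadrantKernel {η : ℝ} (hη : 0 < η) : Nonempty (QuadrantKernel η) := by
  obtain ⟨n, hn⟩ : ∃ n, 1 - η < ∫ t, signIter (n + 1) (Real.cos t) ^ 2 ∂circleProb :=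
    (((tendsto_add_atTop_iff_nat 1).2 tendsto_integral_signIter_cos_sq).eventually
      (lt_mem_nhds (by linarith : 1 - η < 1))).exists
  set C := cosWave (n + 1) with hC
  set S := sinWave (n + 1) with hS
  have hCt : IsRealTrig C := isRealTrig_cosWave _
  have hSt : IsRealTrig S := isRealTrig_sinWave _
  have hC_pi : ∀ t, C (t + Real.pi) = -C t := cosWave_add_pi _
  have hS_pi : ∀ t, S (t + Real.pi) = -S t := sinWave_add_pi _
  have hS_half : ∀ t, S (t + Real.pi / 2) = C t := sinWave_add_pi_div_two _
  have hC1 : ∀ t, |C t| ≤ 1 := abs_cosWave_le_one _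
  have hS1 : ∀ t, |S t| ≤ 1 := abs_sinWave_le_one _
  have mC : circleMean C = 0 := circleMean_cosWave _
  have mS : circleMean S = 0 := circleMean_sinWave _
  have mSC : circleMean (S * C) = 0 := circleMean_sin_mul_cosWave _
  have mSS : circleMean (S * S) = circleMean (C * C) := circleMean_sinWave_sq _
  obtain ⟨gC, hgC, eC⟩ := exists_analytic_completion hCt
  obtain ⟨g0, hg0, e0⟩ := exists_analytic_completion (hSt.mul hCt)
  rw [← circleMean_apply, mC] at eC
  rw [show ∫ x, S x * C x ∂circleProb = 0 from mSC] at e0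
  simp only [zero_add] at eC e0
  obtain ⟨gS, hgS⟩ : ∃ gS : ℝ → ℂ, gS = fun t => gC (t + -(Real.pi / 2)) := ⟨_, rfl⟩
  have hgSm : gS ∈ analyticModes := hgS ▸ translate_mem_modes _ hgC
  have eS : ∀ t, S t = (gS t).re := fun t => by
    rw [hgS, ← eC, ← hS_half]
    congr 1
    ring
  -- Averaging over the period `π` of `S * C` makes the conjugate function `π`-periodic as well.
  obtain ⟨gD, hgD⟩ : ∃ gD : ℝ → ℂ, gD = (1 / 2 : ℂ) • (g0 + fun t => g0 (t + Real.pi)) := ⟨_, rfl⟩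
  have hgDm : gD ∈ analyticModes :=
    hgD ▸ Submodule.smul_mem _ _ (add_mem hg0 (translate_mem_modes _ hg0))
  have eD : ∀ t, (S * C) t = (gD t).re := fun t => by
    have h1 := e0 t
    have h2 := e0 (t + Real.pi)
    rw [hS_pi, hC_pi] at h2
    rw [hgD]
    simp only [ContinuousMap.mul_apply, Pi.smul_apply, Pi.add_apply, smul_eq_mul]
    have : (1 / 2 * (g0 t + g0 (t + Real.pi))).re =
        1 / 2 * ((g0 t).re + (g0 (t + Real.pi)).re) := by
      simp [Complex.mul_re]
    rw [this]
    linarith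
  have hD_pi : ∀ t, gD (t + Real.pi) = gD t := fun t => by
    rw [hgD]
    simp only [Pi.smul_apply, Pi.add_apply]
    rw [show t + Real.pi + Real.pi = t + 2 * Real.pi by ring, periodic_of_mem_modes hg0, add_comm]
  set C' : C(ℝ, ℝ) := ⟨fun t => (gC t).im, (IsRealTrig.im hgC).continuous⟩
  set S' : C(ℝ, ℝ) := ⟨fun t => (gS t).im, (IsRealTrig.im hgSm).continuous⟩
  set D' : C(ℝ, ℝ) := ⟨fun t => (gD t).im, (IsRealTrig.im hgDm).continuous⟩
  have eC' : ∀ t, C' t = (gC t).im := fun t => rfl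
  have eS' : ∀ t, S' t = (gS t).im := fun t => rfl
  have eD' : ∀ t, D' t = (gD t).im := fun t => rfl
  have hD't : IsRealTrig D' := IsRealTrig.im hgDm
  have hb : 17 / 64 ≤ circleMean (S * C') := circleMean_sinWave_mul_im_ge n hgC eC eC'
  have m1 : circleMean C' = 0 := circleMean_im hgC eC'
  have m2 : circleMean S' = 0 := circleMean_im hgSm eS'
  have m3 : circleMean D' = 0 := circleMean_im hgDm eD'
  have m4 : circleMean (C * C') = 0 := by
    have := circleMean_antisymm hgC hgC eC eC' eC eC'
    linarith
  have m5 : circleMean (S * S') = 0 := by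
    have := circleMean_antisymm hgSm hgSm eS eS' eS eS'
    linarith
  have m6 : circleMean (S * C * D') = 0 := by
    have := circleMean_antisymm hgDm hgDm eD eD' eD eD'
    linarith
  have m7 : circleMean (C * S') = -circleMean (S * C') := circleMean_antisymm hgC hgSm eC eC' eS eS'
  -- `C` and `S` change sign under translation by `π`, while `D'` does not.
  have m8 : circleMean (C * D') = 0 :=
    circleMean_eq_zero (hCt.mul hD't) Real.pi fun t => by
      simp only [ContinuousMap.mul_apply, eD', hD_pi, hC_pi, neg_mul]
  have m9 : circleMean (S * D') = 0 :=
    circleMean_eq_zero (hSt.mul hD't) Real.pi fun t => by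
      simp only [ContinuousMap.mul_apply, eD', hD_pi, hS_pi, neg_mul]
  have m10 : circleMean (S * C * C') = 0 := by
    rw [circleMean_antisymm hgDm hgC eD eD' eC eC', m8, neg_zero]
  have m11 : circleMean (S * C * S') = 0 := by
    rw [circleMean_antisymm hgDm hgSm eD eD' eS eS', m9, neg_zero]
  have m12 : circleMean (S * (S * C)) = 0 :=
    circleMean_eq_zero (hSt.mul (hSt.mul hCt)) Real.pi fun t => by
      simp only [ContinuousMap.mul_apply, hC_pi, hS_pi]
      ring
  have m13 : circleMean (C * (S * C)) = 0 :=
    circleMean_eq_zero (hCt.mul (hSt.mul hCt)) Real.pi fun t => by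
      simp only [ContinuousMap.mul_apply, hC_pi, hS_pi]
      ring
  set ρ := circleMean (C * C) with hρ
  set σ := circleMean (S * C * (S * C)) with hσ
  have hCsq : ∀ t, C t * C t ≤ 1 := fun t => by
    have := abs_le.1 (hC1 t)
    nlinarith
  have hSsq : ∀ t, S t * S t ≤ 1 := fun t => by
    have := abs_le.1 (hS1 t)
    nlinarith
  have hρ1 : ρ ≤ 1 := circleMean_one ▸ circleMean_mono hCsq
  have hρ2 : 1 - η < ρ := by
    refine hn.trans_eq ?_
    rw [hρ, circleMean_apply]
    congr 1 with t
    exact sq _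
  have hσ1 : σ ≤ 1 := by
    refine circleMean_one ▸ circleMean_mono fun t => ?_
    simp only [ContinuousMap.mul_apply, ContinuousMap.one_apply]
    nlinarith [hCsq t, hSsq t, mul_self_nonneg (C t), mul_self_nonneg (S t),
      mul_nonneg (sub_nonneg.2 (hCsq t)) (mul_self_nonneg (S t))]
  have hσ2 : 2 * ρ - 1 ≤ σ := by
    have : circleMean (S * S + C * C - 1) ≤ circleMean (S * C * (S * C)) :=
      circleMean_mono fun t => by
        simp only [ContinuousMap.mul_apply, ContinuousMap.one_apply, ContinuousMap.add_apply,
          ContinuousMap.sub_apply]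
        nlinarith [mul_nonneg (sub_nonneg.2 (hCsq t)) (sub_nonneg.2 (hSsq t))]
    rw [map_sub, map_add, circleMean_one, mSS] at this
    linarith
  obtain ⟨k, hk⟩ : ∃ k : ℕ → C(ℝ, ℝ), k = fun q => (1 / 4 : ℝ) • 1 + (secondSign q / 4) • S +
      (firstSign q * secondSign q / 4) • C + (firstSign q / 4) • (S * C) := ⟨_, rfl⟩
  have hk_apply : ∀ q t, k q t =
      1 / 4 * (1 + secondSign q * S t) * (1 + firstSign q * secondSign q * C t) := fun q t => by
    rw [hk]
    simp only [ContinuousMap.add_apply, ContinuousMap.smul_apply, ContinuousMap.mul_apply,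
      ContinuousMap.one_apply, smul_eq_mul]
    rcases secondSign_eq q with h | h <;> rw [h] <;> ring
  obtain ⟨R1, h1⟩ := exists_degree_bound hgC
  obtain ⟨R2, h2⟩ := exists_degree_bound hgSm
  obtain ⟨R3, h3⟩ := exists_degree_bound hgDm
  have hsub : ∀ {R R' : ℕ}, R ≤ R' → modes ({n : ℤ | 1 ≤ n} ∩ {n | |n| ≤ (R : ℤ)}) ≤
      modes ({n : ℤ | 1 ≤ n} ∩ {n | |n| ≤ (R' : ℤ)}) := fun h =>
    modes_mono (Set.inter_subset_inter_right _ fun m (hm : |m| ≤ _) =>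
      hm.trans (Int.ofNat_le.2 h))
  obtain ⟨v0, v1, v2, v3, w0, w1, w2, w3⟩ := sign_values
  refine ⟨⟨fun q => k q, fun q => ((secondSign q / 4 : ℝ) : ℂ) • gS +
      ((firstSign q * secondSign q / 4 : ℝ) : ℂ) • gC + ((firstSign q / 4 : ℝ) : ℂ) • gD,
    R1 + R2 + R3, circleMean (S * C'), fun q t => ?_, fun t => ?_, fun q t => ?_, fun q => ?_, hb,
    fun q' q => ?_, fun q' hq' q hq => ?_⟩⟩
  · have hs := abs_le.1 (hS1 t)
    have hc := abs_le.1 (hC1 t)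
    rw [hk_apply]
    refine mul_nonneg (mul_nonneg (by norm_num) ?_) ?_
    · rcases secondSign_eq q with h | h <;> rw [h] <;> linarith
    · rcases secondSign_eq q with h | h <;> rcases firstSign_eq q with h' | h' <;>
        rw [h, h'] <;> linarith
  · simp only [hk_apply, Finset.sum_range_succ, Finset.sum_range_zero, v0, v1, v2, v3, w0, w1, w2,
      w3]
    ring
  · simp only [hk, ContinuousMap.add_apply, ContinuousMap.smul_apply, ContinuousMap.one_apply,
      smul_eq_mul, Pi.add_apply, Pi.smul_apply, Complex.add_re, Complex.re_ofReal_mul, eC, eS, eD]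
    ring
  · exact add_mem (add_mem (Submodule.smul_mem _ _ (hsub (by omega) h2))
      (Submodule.smul_mem _ _ (hsub (by omega) h1)))
      (Submodule.smul_mem _ _ (hsub (by omega) h3))
  · have e : ∫ t, k q' t * ((((secondSign q / 4 : ℝ) : ℂ) • gS +
        ((firstSign q * secondSign q / 4 : ℝ) : ℂ) • gC +
        ((firstSign q / 4 : ℝ) : ℂ) • gD) t).im ∂circleProb =
        circleMean (k q' * ((secondSign q / 4) • S' + (firstSign q * secondSign q / 4) • C' +
          (firstSign q / 4) • D')) := by
      simp only [circleMean_apply, ContinuousMap.mul_apply, ContinuousMap.add_apply,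
        ContinuousMap.smul_apply, Pi.add_apply, Pi.smul_apply, smul_eq_mul, Complex.add_im,
        Complex.im_ofReal_mul, eC', eS', eD']
    rw [e, hk]
    simp only [mul_add, add_mul, smul_mul_assoc, mul_smul_comm, one_mul, map_add, map_smul,
      smul_eq_mul, m1, m2, m3, m4, m5, m6, m7, m8, m9, m10, m11]
    rw [blockShift]
    rcases secondSign_eq q with h | h <;> rw [h] <;>
      rcases secondSign_eq q' with h' | h' <;> rw [h'] <;> ring
  · have e : ∫ t, k q' t * k q t ∂circleProb = circleMean (k q' * k q) := rfl
    have m12' : circleMean (S * C * S) = 0 := by rw [mul_comm, m12]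
    have m13' : circleMean (S * C * C) = 0 := by rw [mul_comm, m13]
    have mCS : circleMean (C * S) = 0 := by rw [mul_comm, mSC]
    have e2 : 4 * circleMean (k q' * k q) = 1 / 4 * (1 + secondSign q' * secondSign q * ρ +
        firstSign q' * secondSign q' * (firstSign q * secondSign q) * ρ +
        firstSign q' * firstSign q * σ) := by
      rw [hk]
      simp only [mul_add, add_mul, smul_mul_assoc, mul_smul_comm, one_mul, mul_one, map_add,
        map_smul, smul_eq_mul, circleMean_one, mC, mS, mSC, mCS, m12, m13, m12', m13', mSS]
      rw [← hρ, ← hσ]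
      ring
    rw [e, e2]
    exact abs_signs_sub_ite_le hρ1 hρ2 hσ1 hσ2 hq' hq

/-! ### Weights on dyadic intervals and their correlations -/

theorem sum_range_mul_four {A : Type*} [AddCommMonoid A] (F : ℕ → A) (n : ℕ) :
    ∑ j ∈ Finset.range (4 * n), F j =
      ∑ i ∈ Finset.range n, ∑ r ∈ Finset.range 4, F (4 * i + r) := by
  induction n with
  | zero => simp
  | succ n ih => rw [Finset.sum_range_succ, ← ih, mul_add, mul_one, Finset.sum_range_add]

theorem sum_range_four_pow_succ {A : Type*} [AddCommMonoid A] (F : ℕ → A) (M : ℕ) :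
    ∑ j ∈ Finset.range (4 ^ (M + 1)), F j =
      ∑ i ∈ Finset.range (4 ^ M), ∑ r ∈ Finset.range 4, F (4 * i + r) := by
  rw [pow_succ', sum_range_mul_four]

theorem four_mul_add_div {r : ℕ} (hr : r < 4) (i : ℕ) : (4 * i + r) / 4 = i := by omega

theorem four_mul_add_mod {r : ℕ} (hr : r < 4) (i : ℕ) : (4 * i + r) % 4 = r := by omega

theorem integral_mul_dilate_real {N : ℕ} {u v : ℝ → ℝ}
    (hu : (fun t => (u t : ℂ)) ∈ modes {n | |n| < (N : ℤ)}) (hv : IsRealTrig v) :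
    ∫ t, u t * v (N * t) ∂circleProb = (∫ t, u t ∂circleProb) * ∫ t, v t ∂circleProb := by
  have := integral_mul_dilate hu hv
  simp_rw [← Complex.ofReal_mul] at this
  simp only [integral_complex_ofReal] at this
  exact_mod_cast this

namespace QuadrantKernel

variable {η : ℝ} (κ : QuadrantKernel η)

/-- The frequency at which the `M`-th base-`4` digit is encoded on the circle. -/
def freq (M : ℕ) : ℕ := (2 * κ.R + 1) ^ M

/-- The weight of the `j`-th dyadic interval of level `2 M`: the product over the base-`4` digits of
`j` of the values of the kernel at rapidly increasing frequencies. -/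
noncomputable def weight : ℕ → ℕ → ℝ → ℝ
  | 0, _, _ => 1
  | M + 1, j, t => weight M (j / 4) t * κ.K (j % 4) (κ.freq M * t)

/-- The analytic completion of `weight M j - 4⁻ᴹ`. Its recursion says that multiplication by a
polynomial of low degree commutes with the Hilbert transform on functions of high frequency. -/
noncomputable def completion : ℕ → ℕ → ℝ → ℂ
  | 0, _, _ => 0
  | M + 1, j, t =>
    weight κ M (j / 4) t * κ.G (j % 4) (κ.freq M * t) + 1 / 4 * completion M (j / 4) t

theorem weight_nonneg (M j : ℕ) (t : ℝ) : 0 ≤ κ.weight M j t := by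
  induction M generalizing j with
  | zero => exact zero_le_one
  | succ M ih => exact mul_nonneg (ih _) (κ.nonneg _ _)

theorem sum_weight (M : ℕ) (t : ℝ) : ∑ j ∈ Finset.range (4 ^ M), κ.weight M j t = 1 := by
  induction M with
  | zero => simp [weight]
  | succ M ih =>
    rw [sum_range_four_pow_succ, ← ih]
    refine Finset.sum_congr rfl fun i _ => ?_
    rw [← mul_one (κ.weight M i t), ← κ.sum_eq_one (κ.freq M * t), Finset.mul_sum]
    refine Finset.sum_congr rfl fun r hr => ?_
    rw [weight, four_mul_add_div (Finset.mem_range.1 hr), four_mul_add_mod (Finset.mem_range.1 hr)]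

theorem weight_eq (M j : ℕ) (t : ℝ) : κ.weight M j t = (1 / 4) ^ M + (κ.completion M j t).re := by
  induction M generalizing j with
  | zero => simp [weight, completion]
  | succ M ih =>
    have h4 : (1 / 4 : ℂ) = ((1 / 4 : ℝ) : ℂ) := by push_cast; rfl
    rw [weight, completion, κ.eq_re, Complex.add_re, Complex.re_ofReal_mul, h4,
      Complex.re_ofReal_mul, mul_add, ih (j / 4), pow_succ]
    ring

theorem completion_im_succ (M j : ℕ) (t : ℝ) : (κ.completion (M + 1) j t).im =
    κ.weight M (j / 4) t * (κ.G (j % 4) (κ.freq M * t)).im +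
      1 / 4 * (κ.completion M (j / 4) t).im := by
  have h4 : (1 / 4 : ℂ) = ((1 / 4 : ℝ) : ℂ) := by push_cast; rfl
  rw [completion, Complex.add_im, Complex.im_ofReal_mul, h4, Complex.im_ofReal_mul]

/-- The frequencies of the level `M` weights: products of two of them have degree below `freq M`. -/
def lowFreq (M : ℕ) : Set ℤ := {n | 2 * |n| < (κ.freq M : ℤ)}

theorem neg_mem_lowFreq (M : ℕ) : ∀ n ∈ κ.lowFreq M, -n ∈ κ.lowFreq M := fun n hn => by
  simpa [lowFreq] using hn

theorem freq_pos (M : ℕ) : 0 < κ.freq M := Nat.pow_pos (Nat.succ_pos _)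

theorem ofReal_mem_modes {s : Set ℤ} (hs : 0 ∈ s) {u : ℝ → ℝ} {c : ℝ} {g : ℝ → ℂ}
    (hu : ∀ t, u t = c + (g t).re) (hneg : ∀ n ∈ s, -n ∈ s) (hg : g ∈ modes s) :
    (fun t => (u t : ℂ)) ∈ modes s := by
  have := add_mem (Submodule.smul_mem _ (c : ℂ) (one_mem_modes hs)) (ofReal_re_mem_modes hneg hg)
  have h : (fun t => (u t : ℂ)) = (c : ℂ) • (1 : ℝ → ℂ) + fun t => ((g t).re : ℂ) := by
    ext t
    simp [hu]
  rwa [h]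

theorem ofReal_K_mem_modes (q : ℕ) :
    (fun t => (κ.K q t : ℂ)) ∈ modes {n | |n| ≤ (κ.R : ℤ)} :=
  ofReal_mem_modes (by simp) (κ.eq_re q) (by simp)
    (modes_mono Set.inter_subset_right (κ.mem_modes q))

theorem isRealTrig_K (q : ℕ) : IsRealTrig (κ.K q) :=
  modes_mono (Set.subset_univ _) (κ.ofReal_K_mem_modes q)

theorem zero_mem_lowFreq (M : ℕ) : 0 ∈ κ.lowFreq M := by
  simpa [lowFreq] using κ.freq_pos M

/-- The ratio `2 R + 1` of consecutive frequencies is chosen to make this true. -/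
theorem add_mem_lowFreq_succ (M : ℕ) {m n : ℤ} (hm : m ∈ κ.lowFreq M) (hn : |n| ≤ (κ.R : ℤ)) :
    m + κ.freq M * n ∈ κ.lowFreq (M + 1) := by
  have hf : (κ.freq (M + 1) : ℤ) = κ.freq M * (2 * κ.R + 1) := by
    simp [freq, pow_succ]
  have hp : (0 : ℤ) < κ.freq M := by exact_mod_cast κ.freq_pos M
  have h1 : 2 * |m| < (κ.freq M : ℤ) := hm
  change 2 * |m + κ.freq M * n| < (κ.freq (M + 1) : ℤ)
  rw [hf]
  have h2 := abs_add_le m (κ.freq M * n)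
  rw [abs_mul, abs_of_pos hp] at h2
  nlinarith [mul_le_mul_of_nonneg_left hn hp.le]

theorem completion_mem_modes (M j : ℕ) :
    κ.completion M j ∈ modes ({n | 1 ≤ n} ∩ κ.lowFreq M) := by
  induction M generalizing j with
  | zero => exact zero_mem _
  | succ M ih =>
    have hp : (0 : ℤ) < κ.freq M := by exact_mod_cast κ.freq_pos M
    have hw : (fun t => (κ.weight M (j / 4) t : ℂ)) ∈ modes (κ.lowFreq M) :=
      ofReal_mem_modes (κ.zero_mem_lowFreq M) (κ.weight_eq M _) (κ.neg_mem_lowFreq M)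
        (modes_mono Set.inter_subset_right (ih _))
    have hG := dilate_mem_modes
      (r := {m | ∃ n, (1 ≤ n ∧ |n| ≤ (κ.R : ℤ)) ∧ (κ.freq M : ℤ) * n = m})
      (fun n hn => ⟨n, hn, rfl⟩) (κ.mem_modes (j % 4))
    refine add_mem (mul_mem_modes (f := fun t => (κ.weight M (j / 4) t : ℂ))
      (g := fun t => κ.G (j % 4) (κ.freq M * t)) ?_ hw hG)
      (Submodule.smul_mem _ (1 / 4 : ℂ) (modes_mono ?_ (ih (j / 4))))
    · rintro m hm _ ⟨n, ⟨hn1, hn2⟩, rfl⟩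
      refine ⟨?_, κ.add_mem_lowFreq_succ M hm hn2⟩
      have h1 : 2 * |m| < (κ.freq M : ℤ) := hm
      have h2 := neg_abs_le m
      have h3 := abs_nonneg m
      change 1 ≤ m + κ.freq M * n
      nlinarith
    · rintro n ⟨hn1, hn2⟩
      refine ⟨hn1, ?_⟩
      simpa using κ.add_mem_lowFreq_succ M hn2 (n := 0) (by simp)

theorem completion_mem_analyticModes (M j : ℕ) : κ.completion M j ∈ analyticModes :=
  modes_mono Set.inter_subset_left (κ.completion_mem_modes M j)

theorem ofReal_weight_mem_modes (M j : ℕ) :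
    (fun t => (κ.weight M j t : ℂ)) ∈ modes (κ.lowFreq M) :=
  ofReal_mem_modes (κ.zero_mem_lowFreq M) (κ.weight_eq M _) (κ.neg_mem_lowFreq M)
    (modes_mono Set.inter_subset_right (κ.completion_mem_modes M j))

theorem isRealTrig_weight (M j : ℕ) : IsRealTrig (κ.weight M j) :=
  modes_mono (Set.subset_univ _) (κ.ofReal_weight_mem_modes M j)

@[fun_prop]
theorem continuous_weight (M j : ℕ) : Continuous (κ.weight M j) :=
  (κ.isRealTrig_weight M j).continuous

@[fun_prop]
theorem continuous_completion (M j : ℕ) : Continuous (κ.completion M j) :=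
  continuous_of_mem_modes (κ.completion_mem_modes M j)

@[fun_prop]
theorem continuous_K (q : ℕ) : Continuous (κ.K q) := (κ.isRealTrig_K q).continuous

@[fun_prop]
theorem continuous_G (q : ℕ) : Continuous (κ.G q) := continuous_of_mem_modes (κ.mem_modes q)

theorem integral_weight (M j : ℕ) : ∫ t, κ.weight M j t ∂circleProb = (1 / 4) ^ M := by
  simp_rw [weight_eq]
  rw [integral_add (integrable_const _) (integrable_circleProb_of_continuous (by fun_prop)),
    integral_re_analyticModes (κ.completion_mem_analyticModes M j)]
  simp

theorem integral_K (q : ℕ) : ∫ t, κ.K q t ∂circleProb = 1 / 4 := by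
  simp_rw [eq_re]
  rw [integral_add (integrable_const _) (integrable_circleProb_of_continuous (by fun_prop)),
    integral_re_analyticModes (modes_mono Set.inter_subset_left (κ.mem_modes q))]
  simp

theorem mul_mem_modes_freq {M : ℕ} {u v : ℝ → ℝ} (hu : (fun t => (u t : ℂ)) ∈ modes (κ.lowFreq M))
    (hv : (fun t => (v t : ℂ)) ∈ modes (κ.lowFreq M)) :
    (fun t => ((u t * v t : ℝ) : ℂ)) ∈ modes {n | |n| < (κ.freq M : ℤ)} := by
  simp only [Complex.ofReal_mul]
  refine mul_mem_modes (fun m hm n hn => ?_) hu hv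
  have h1 : 2 * |m| < (κ.freq M : ℤ) := hm
  have h2 : 2 * |n| < (κ.freq M : ℤ) := hn
  have h3 := abs_add_le m n
  change |m + n| < _
  linarith

/-- The normalized correlations of the weights. -/
noncomputable def gram (M j' j : ℕ) : ℝ :=
  4 ^ M * ∫ t, κ.weight M j' t * κ.weight M j t ∂circleProb

/-- The normalized correlations of the weights with their Hilbert transforms. -/
noncomputable def cross (M j' j : ℕ) : ℝ :=
  4 ^ M * ∫ t, κ.weight M j' t * (κ.completion M j t).im ∂circleProb

theorem gram_succ (M j' j : ℕ) : κ.gram (M + 1) j' j =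
    κ.gram M (j' / 4) (j / 4) * (4 * ∫ t, κ.K (j' % 4) t * κ.K (j % 4) t ∂circleProb) := by
  have h := integral_mul_dilate_real
    (κ.mul_mem_modes_freq (κ.ofReal_weight_mem_modes M (j' / 4))
      (κ.ofReal_weight_mem_modes M (j / 4)))
    ((κ.isRealTrig_K (j' % 4)).mul (κ.isRealTrig_K (j % 4)))
  have e : ∀ t, κ.weight (M + 1) j' t * κ.weight (M + 1) j t =
      κ.weight M (j' / 4) t * κ.weight M (j / 4) t *
        (κ.K (j' % 4) (κ.freq M * t) * κ.K (j % 4) (κ.freq M * t)) := fun t => by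
    rw [weight, weight]
    ring
  rw [gram, gram]
  simp_rw [e]
  rw [h, pow_succ]
  ring

theorem cross_succ (M j' j : ℕ) : κ.cross (M + 1) j' j =
    κ.gram M (j' / 4) (j / 4) * (κ.b * blockShift (j' % 4) (j % 4)) +
      1 / 4 * κ.cross M (j' / 4) (j / 4) := by
  have h1 := integral_mul_dilate_real
    (κ.mul_mem_modes_freq (κ.ofReal_weight_mem_modes M (j' / 4))
      (κ.ofReal_weight_mem_modes M (j / 4)))
    ((κ.isRealTrig_K (j' % 4)).mul (IsRealTrig.im (κ.mem_modes (j % 4))))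
  have h2 := integral_mul_dilate_real
    (κ.mul_mem_modes_freq (κ.ofReal_weight_mem_modes M (j' / 4))
      (ofReal_im_mem_modes (κ.neg_mem_lowFreq M)
        (modes_mono Set.inter_subset_right (κ.completion_mem_modes M (j / 4)))))
    (κ.isRealTrig_K (j' % 4))
  have e : ∀ t, κ.weight (M + 1) j' t * (κ.completion (M + 1) j t).im =
      κ.weight M (j' / 4) t * κ.weight M (j / 4) t *
        (κ.K (j' % 4) (κ.freq M * t) * (κ.G (j % 4) (κ.freq M * t)).im) +
      1 / 4 * (κ.weight M (j' / 4) t * (κ.completion M (j / 4) t).im *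
        κ.K (j' % 4) (κ.freq M * t)) := fun t => by
    rw [completion_im_succ, weight]
    ring
  rw [cross]
  simp_rw [e]
  rw [integral_add (integrable_circleProb_of_continuous (by fun_prop))
    (integrable_circleProb_of_continuous (by fun_prop)), integral_const_mul, h1, h2, integral_K,
    ← κ.shift, gram, cross, pow_succ]
  ring

end QuadrantKernel

/-- The limit of the normalized matrices `cross`: the sum over the base-`4` digits of the operator
`blockShift` acting in that digit, averaged over the digits that follow. -/
noncomputable def shiftMatrix : ℕ → ℕ → ℕ → ℝ
  | 0, _, _ => 0
  | M + 1, j', j => (if j' / 4 = j / 4 then blockShift (j' % 4) (j % 4) else 0) +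
      1 / 4 * shiftMatrix M (j' / 4) (j / 4)

theorem tendsto_gram {η : ℕ → ℝ} (hη : Tendsto η atTop (𝓝 0)) (κ : ∀ n, QuadrantKernel (η n))
    (M : ℕ) {j' j : ℕ} (hj' : j' < 4 ^ M) (hj : j < 4 ^ M) :
    Tendsto (fun n => (κ n).gram M j' j) atTop (𝓝 (if j' = j then 1 else 0)) := by
  induction M generalizing j' j with
  | zero =>
    have h : j' = j := by omega
    simp [QuadrantKernel.gram, QuadrantKernel.weight, h]
  | succ M ih =>
    rw [pow_succ] at hj hj'
    simp_rw [QuadrantKernel.gram_succ]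
    have h1 := ih (j' := j' / 4) (j := j / 4) (by omega) (by omega)
    have h2 : Tendsto (fun n => 4 * ∫ t, (κ n).K (j' % 4) t * (κ n).K (j % 4) t ∂circleProb) atTop
        (𝓝 (if j' % 4 = j % 4 then 1 else 0)) := by
      rw [tendsto_iff_norm_sub_tendsto_zero]
      exact squeeze_zero (fun _ => norm_nonneg _)
        (fun n => (κ n).near _ (Nat.mod_lt _ (by norm_num)) _ (Nat.mod_lt _ (by norm_num))) hη
    convert h1.mul h2 using 2
    by_cases h : j' = j
    · simp [h]
    · by_cases h3 : j' / 4 = j / 4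
      · have h4 : j' % 4 ≠ j % 4 := by omega
        simp [h, h4]
      · simp [h, h3]

theorem tendsto_cross {η : ℕ → ℝ} (hη : Tendsto η atTop (𝓝 0)) (κ : ∀ n, QuadrantKernel (η n))
    (M : ℕ) {j' j : ℕ} (hj' : j' < 4 ^ M) (hj : j < 4 ^ M) :
    Tendsto (fun n => ((κ n).b)⁻¹ * (κ n).cross M j' j) atTop (𝓝 (shiftMatrix M j' j)) := by
  induction M generalizing j' j with
  | zero => simp [QuadrantKernel.cross, QuadrantKernel.completion, shiftMatrix]
  | succ M ih =>
    rw [pow_succ] at hj hj'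
    have hd : j' / 4 < 4 ^ M ∧ j / 4 < 4 ^ M := by omega
    have h1 := ((tendsto_gram hη κ M hd.1 hd.2).mul_const (blockShift (j' % 4) (j % 4))).add
      ((ih hd.1 hd.2).const_mul (1 / 4))
    rw [ite_mul, one_mul, zero_mul] at h1
    refine h1.congr fun n => ?_
    have hb : (κ n).b ≠ 0 := by linarith [(κ n).lower]
    rw [QuadrantKernel.cross_succ]
    field_simp

variable {X : Type*} [NormedAddCommGroup X] [NormedSpace ℝ X]

/-- The averages over the four grandchildren. -/
noncomputable def blockAvg (f : ℕ → X) (i : ℕ) : X :=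
  (1 / 4 : ℝ) • ∑ r ∈ Finset.range 4, f (4 * i + r)

/-- The operator `blockShift` acting in the last base-`4` digit. -/
noncomputable def localShift (f : ℕ → X) (j : ℕ) : X :=
  ∑ r ∈ Finset.range 4, blockShift (j % 4) r • f (4 * (j / 4) + r)

/-- The part of the dyadic Hilbert transform acting within the digits of the base-`4` expansion,
for functions on dyadic intervals of level `2 M`. -/
noncomputable def digitShift : ℕ → (ℕ → X) → ℕ → X
  | 0, _, _ => 0
  | M + 1, f, j => digitShift M (blockAvg f) (j / 4) + localShift f j

theorem sum_shiftMatrix (M : ℕ) (f : ℕ → X) {j' : ℕ} (hj' : j' < 4 ^ M) :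
    ∑ j ∈ Finset.range (4 ^ M), shiftMatrix M j' j • f j = digitShift M f j' := by
  induction M generalizing f j' with
  | zero => simp [shiftMatrix, digitShift]
  | succ M ih =>
    rw [pow_succ] at hj'
    have hd : j' / 4 < 4 ^ M := by omega
    have e : ∀ i, ∑ r ∈ Finset.range 4, shiftMatrix (M + 1) j' (4 * i + r) • f (4 * i + r) =
        (if j' / 4 = i then ∑ r ∈ Finset.range 4, blockShift (j' % 4) r • f (4 * i + r) else 0) +
          shiftMatrix M (j' / 4) i • blockAvg f i := fun i => by
      have : ∀ r ∈ Finset.range 4, shiftMatrix (M + 1) j' (4 * i + r) • f (4 * i + r) =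
          (if j' / 4 = i then blockShift (j' % 4) r • f (4 * i + r) else 0) +
            shiftMatrix M (j' / 4) i • (1 / 4 : ℝ) • f (4 * i + r) := fun r hr => by
        rw [shiftMatrix, four_mul_add_div (Finset.mem_range.1 hr),
          four_mul_add_mod (Finset.mem_range.1 hr), add_smul, ite_smul, zero_smul, smul_smul,
          mul_comm (shiftMatrix M (j' / 4) i)]
      rw [Finset.sum_congr rfl this, Finset.sum_add_distrib, blockAvg, Finset.smul_sum,
        Finset.smul_sum]
      split_ifs <;> simp
    rw [sum_range_four_pow_succ, Finset.sum_congr rfl fun i _ => e i, Finset.sum_add_distrib,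
      ih _ hd, Finset.sum_ite_eq, if_pos (Finset.mem_range.2 hd), digitShift, localShift, add_comm]

/-! ### Contractions, and the bound for the digitwise shift -/

/-- Jensen's inequality for the probability density `W`. -/
theorem lintegral_mul_rpow_le {α : Type*} [MeasurableSpace α] {μ : Measure α} {W h : α → ℝ≥0∞}
    (hW : Measurable W) (hh : AEMeasurable h μ) (h1 : ∫⁻ a, W a ∂μ = 1) {P : ℝ} (hP : 1 ≤ P) :
    (∫⁻ a, W a * h a ∂μ) ^ P ≤ ∫⁻ a, W a * h a ^ P ∂μ := by
  have hP0 : 0 < P := by linarith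
  have : IsProbabilityMeasure (μ.withDensity W) := ⟨by simp [h1]⟩
  have hh' : AEMeasurable h (μ.withDensity W) :=
    hh.mono_ac (withDensity_absolutelyContinuous μ W)
  have key := eLpNorm'_le_eLpNorm'_of_exponent_le (ε := ℝ≥0∞) (f := h) zero_lt_one hP
    (μ.withDensity W) hh'.aestronglyMeasurable
  simp only [eLpNorm', enorm_eq_self, ENNReal.rpow_one, one_div, inv_one] at key
  rw [lintegral_withDensity_eq_lintegral_mul₀ hW.aemeasurable hh,
    lintegral_withDensity_eq_lintegral_mul₀ hW.aemeasurable (hh.pow_const P)] at key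
  simp only [Pi.mul_apply] at key
  calc _ ≤ ((∫⁻ a, W a * h a ^ P ∂μ) ^ P⁻¹) ^ P := ENNReal.rpow_le_rpow key hP0.le
    _ = _ := by rw [← ENNReal.rpow_mul, inv_mul_cancel₀ hP0.ne', ENNReal.rpow_one]

theorem lintegral_ofReal_circleProb {u : ℝ → ℝ} (hu : Continuous u) (h0 : ∀ t, 0 ≤ u t) :
    ∫⁻ t, ENNReal.ofReal (u t) ∂circleProb = ENNReal.ofReal (∫ t, u t ∂circleProb) :=
  (ofReal_integral_eq_lintegral_ofReal (integrable_circleProb_of_continuous hu)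
    (ae_of_all _ h0)).symm

theorem enorm_smul_of_nonneg {r : ℝ} (hr : 0 ≤ r) (x : X) :
    ‖r • x‖ₑ = ENNReal.ofReal r * ‖x‖ₑ := by
  rw [enorm_smul, Real.enorm_eq_ofReal hr]

namespace QuadrantKernel

variable {η : ℝ} (κ : QuadrantKernel η)

theorem four_pow_mul_ofReal (M : ℕ) : (4 : ℝ≥0∞) ^ M * ENNReal.ofReal ((1 / 4) ^ M) = 1 := by
  rw [show (4 : ℝ≥0∞) ^ M = ENNReal.ofReal (4 ^ M) by
    rw [ENNReal.ofReal_pow (by norm_num)]; norm_num, ← ENNReal.ofReal_mul (by positivity),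
    ← mul_pow]
  norm_num

/-- The interpolation `∑ j, f j w_j` is a contraction in `L^p`. -/
theorem lintegral_sum_weight_le {P : ℝ} (hP : 1 ≤ P) (M : ℕ) (f : ℕ → X) :
    4 ^ M * ∫⁻ t, ‖∑ j ∈ Finset.range (4 ^ M), κ.weight M j t • f j‖ₑ ^ P ∂circleProb ≤
      ∑ j ∈ Finset.range (4 ^ M), ‖f j‖ₑ ^ P := by
  have hP0 : 0 ≤ P := by linarith
  have h1 : ∀ t, ‖∑ j ∈ Finset.range (4 ^ M), κ.weight M j t • f j‖ₑ ^ P ≤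
      ∑ j ∈ Finset.range (4 ^ M), ENNReal.ofReal (κ.weight M j t) * ‖f j‖ₑ ^ P := fun t => by
    refine le_trans (ENNReal.rpow_le_rpow (enorm_sum_le _ _) hP0) ?_
    simp_rw [enorm_smul_of_nonneg (κ.weight_nonneg M _ t)]
    refine ENNReal.rpow_arith_mean_le_arith_mean_rpow _ _ _ ?_ hP
    rw [← ENNReal.ofReal_sum_of_nonneg fun j _ => κ.weight_nonneg M j t, κ.sum_weight,
      ENNReal.ofReal_one]
  calc _ ≤ 4 ^ M * ∫⁻ t, ∑ j ∈ Finset.range (4 ^ M),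
        ENNReal.ofReal (κ.weight M j t) * ‖f j‖ₑ ^ P ∂circleProb := by
        gcongr with t
        exact h1 t
    _ = ∑ j ∈ Finset.range (4 ^ M), ‖f j‖ₑ ^ P := by
        rw [lintegral_finsetSum _ fun j _ => by fun_prop, Finset.mul_sum]
        refine Finset.sum_congr rfl fun j _ => ?_
        rw [lintegral_mul_const _ (by fun_prop),
          lintegral_ofReal_circleProb (by fun_prop) (κ.weight_nonneg M j), integral_weight,
          ← mul_assoc, four_pow_mul_ofReal, one_mul]

/-- The averages against the weights are a contraction in `L^p`. -/
theorem sum_integral_weight_le {P : ℝ} (hP : 1 ≤ P) (M : ℕ) {g : ℝ → X} (hg : Continuous g) :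
    ∑ j ∈ Finset.range (4 ^ M), ‖(4 : ℝ) ^ M • ∫ t, κ.weight M j t • g t ∂circleProb‖ₑ ^ P ≤
      4 ^ M * ∫⁻ t, ‖g t‖ₑ ^ P ∂circleProb := by
  have hgm : Measurable fun t => ‖g t‖ₑ := hg.enorm.measurable
  have hw : ∀ j, Measurable fun t => ENNReal.ofReal (κ.weight M j t) := fun j => by fun_prop
  have h4 : ENNReal.ofReal (4 ^ M) = 4 ^ M := by
    rw [ENNReal.ofReal_pow (by norm_num)]; norm_num
  have h1 : ∀ j, ‖(4 : ℝ) ^ M • ∫ t, κ.weight M j t • g t ∂circleProb‖ₑ ^ P ≤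
      ∫⁻ t, 4 ^ M * ENNReal.ofReal (κ.weight M j t) * ‖g t‖ₑ ^ P ∂circleProb := fun j => by
    refine le_trans (ENNReal.rpow_le_rpow ?_ (by linarith)) (lintegral_mul_rpow_le
      (W := fun t => 4 ^ M * ENNReal.ofReal (κ.weight M j t)) (h := fun t => ‖g t‖ₑ)
      (by fun_prop) (by fun_prop) ?_ hP)
    · rw [enorm_smul_of_nonneg (by positivity), h4]
      simp_rw [mul_assoc]
      rw [lintegral_const_mul _ ((hw j).fun_mul hgm)]
      gcongr
      refine (enorm_integral_le_lintegral_enorm _).trans_eq ?_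
      simp_rw [enorm_smul_of_nonneg (κ.weight_nonneg M _ _)]
    · rw [lintegral_const_mul _ (by fun_prop),
        lintegral_ofReal_circleProb (by fun_prop) (κ.weight_nonneg M j), integral_weight,
        four_pow_mul_ofReal]
  calc _ ≤ ∑ j ∈ Finset.range (4 ^ M),
        ∫⁻ t, 4 ^ M * ENNReal.ofReal (κ.weight M j t) * ‖g t‖ₑ ^ P ∂circleProb :=
        Finset.sum_le_sum fun j _ => h1 j
    _ = ∫⁻ t, 4 ^ M * ‖g t‖ₑ ^ P ∂circleProb := by
        rw [← lintegral_finsetSum _ fun j _ => ((hw j).const_mul _).fun_mul (hgm.pow_const P)]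
        congr 1 with t
        rw [← Finset.sum_mul, ← Finset.mul_sum,
          ← ENNReal.ofReal_sum_of_nonneg fun j _ => κ.weight_nonneg M j t, κ.sum_weight,
          ENNReal.ofReal_one, mul_one]
    _ = _ := lintegral_const_mul _ (hgm.pow_const P)

end QuadrantKernel

/-- `K` bounds the Hilbert transform on the `X`-valued trigonometric polynomials in `L^p`. -/
def IsHilbertBound (X : Type*) [NormedAddCommGroup X] [NormedSpace ℝ X] (p K : ℝ≥0∞) : Prop :=
  ∀ (N : ℕ) (c : X) (a b : ℕ → X), eLpNorm (hilbertTrigPoly N a b) p circleMeasure ≤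
    K * eLpNorm (trigPoly N c a b) p circleMeasure

theorem eLpNorm_rpow_toReal {α E : Type*} [MeasurableSpace α] [NormedAddCommGroup E]
    (μ : Measure α) {p : ℝ≥0∞} (h0 : p ≠ 0) (h1 : p ≠ ∞) (f : α → E) :
    eLpNorm f p μ ^ p.toReal = ∫⁻ t, ‖f t‖ₑ ^ p.toReal ∂μ := by
  rw [eLpNorm_eq_lintegral_rpow_enorm_toReal h0 h1, ← ENNReal.rpow_mul, one_div,
    inv_mul_cancel₀ (ENNReal.toReal_pos h0 h1).ne', ENNReal.rpow_one]

/-- The coefficients serve for all large `N'`, so that several polynomials can share one length. -/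
theorem exists_coeff_of_mem_analyticModes {g : ℝ → ℂ} (hg : g ∈ analyticModes) :
    ∃ (N : ℕ) (a : ℕ → ℂ), ∀ N' ≥ N, ∀ t,
      g t = ∑ n ∈ Finset.range N', a n * expMode (n + 1) t := by
  refine modes_induction (P := fun g => ∃ (N : ℕ) (a : ℕ → ℂ), ∀ N' ≥ N, ∀ t,
      g t = ∑ n ∈ Finset.range N', a n * expMode (n + 1) t) (fun m hm => ?_)
      ⟨0, 0, by simp⟩ ?_ ?_ hg
  · obtain ⟨k, rfl⟩ : ∃ k : ℕ, m = k + 1 := ⟨(m - 1).toNat, by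
      have : 1 ≤ m := hm
      omega⟩
    refine ⟨k + 1, fun n => if n = k then 1 else 0, fun N' hN' t => ?_⟩
    simp only [ite_mul, one_mul, zero_mul]
    rw [Finset.sum_ite_eq', if_pos (Finset.mem_range.2 hN')]
  · rintro f f' - - ⟨N, a, h⟩ ⟨N', a', h'⟩
    refine ⟨max N N', a + a', fun L hL t => ?_⟩
    rw [Pi.add_apply, h L (le_trans (le_max_left _ _) hL), h' L (le_trans (le_max_right _ _) hL),
      ← Finset.sum_add_distrib]
    simp only [Pi.add_apply, add_mul]
  · rintro c f - ⟨N, a, h⟩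
    refine ⟨N, c • a, fun L hL t => ?_⟩
    rw [Pi.smul_apply, h L hL, Finset.smul_sum]
    simp only [Pi.smul_apply, smul_eq_mul, mul_assoc]

/-- The bound for the Hilbert transform, in terms of analytic completions. -/
theorem IsHilbertBound.lintegral_le {p K : ℝ≥0∞} (hK : IsHilbertBound X p K) (h0 : p ≠ 0)
    (h1 : p ≠ ∞) {m : ℕ} {g : ℕ → ℝ → ℂ} (hg : ∀ i, g i ∈ analyticModes) (c : X) (x : ℕ → X) :
    ∫⁻ t, ‖∑ i ∈ Finset.range m, (g i t).im • x i‖ₑ ^ p.toReal ∂circleProb ≤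
      K ^ p.toReal *
        ∫⁻ t, ‖c + ∑ i ∈ Finset.range m, (g i t).re • x i‖ₑ ^ p.toReal ∂circleProb := by
  choose N a ha using fun i => exists_coeff_of_mem_analyticModes (hg i)
  set L := (Finset.range m).sup N with hL
  have hg' : ∀ i ∈ Finset.range m, ∀ t,
      g i t = ∑ n ∈ Finset.range L, a i n * expMode (n + 1) t := fun i hi =>
    ha i L (Finset.le_sup hi)
  have e1 : ∀ t, hilbertTrigPoly L (fun n => ∑ i ∈ Finset.range m, (a i n).re • x i)
      (fun n => ∑ i ∈ Finset.range m, (-(a i n).im) • x i) t =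
      ∑ i ∈ Finset.range m, (g i t).im • x i := fun t => by
    rw [hilbertTrigPoly]
    simp only [Finset.smul_sum, ← Finset.sum_sub_distrib]
    rw [Finset.sum_comm]
    refine Finset.sum_congr rfl fun i hi => ?_
    rw [hg' i hi t, Complex.im_sum, Finset.sum_smul]
    refine Finset.sum_congr rfl fun n _ => ?_
    rw [smul_smul, smul_smul, ← sub_smul, Complex.mul_im, expMode_re, expMode_im]
    push_cast
    ring_nf
  have e2 : ∀ t, trigPoly L c (fun n => ∑ i ∈ Finset.range m, (a i n).re • x i)
      (fun n => ∑ i ∈ Finset.range m, (-(a i n).im) • x i) t =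
      c + ∑ i ∈ Finset.range m, (g i t).re • x i := fun t => by
    rw [trigPoly]
    simp only [Finset.smul_sum, ← Finset.sum_add_distrib]
    rw [Finset.sum_comm]
    congr 1
    refine Finset.sum_congr rfl fun i hi => ?_
    rw [hg' i hi t, Complex.re_sum, Finset.sum_smul]
    refine Finset.sum_congr rfl fun n _ => ?_
    rw [smul_smul, smul_smul, ← add_smul, Complex.mul_re, expMode_re, expMode_im]
    push_cast
    ring_nf
  have key := ENNReal.rpow_le_rpow (hK L c (fun n => ∑ i ∈ Finset.range m, (a i n).re • x i)
    (fun n => ∑ i ∈ Finset.range m, (-(a i n).im) • x i)) (ENNReal.toReal_nonneg (a := p))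
  rw [ENNReal.mul_rpow_of_nonneg _ _ ENNReal.toReal_nonneg, eLpNorm_rpow_toReal _ h0 h1,
    eLpNorm_rpow_toReal _ h0 h1] at key
  simp_rw [e1, e2] at key
  rw [circleProb, lintegral_smul_measure, lintegral_smul_measure, smul_eq_mul, smul_eq_mul,
    mul_left_comm]
  gcongr

/-- The finite form of the comparison: the matrices `cross` inherit the bound of the Hilbert
transform. -/
theorem QuadrantKernel.sum_cross_le [CompleteSpace X] {η : ℝ} (κ : QuadrantKernel η) {p K : ℝ≥0∞}
    (hK : IsHilbertBound X p K) (hp : 1 ≤ p) (h1 : p ≠ ∞) (M : ℕ) (f : ℕ → X) :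
    ∑ j' ∈ Finset.range (4 ^ M),
        ‖∑ j ∈ Finset.range (4 ^ M), κ.cross M j' j • f j‖ₑ ^ p.toReal ≤
      K ^ p.toReal * ∑ j ∈ Finset.range (4 ^ M), ‖f j‖ₑ ^ p.toReal := by
  have h0 : p ≠ 0 := (zero_lt_one.trans_le hp).ne'
  have hP : 1 ≤ p.toReal := by
    rw [← ENNReal.toReal_one]
    exact ENNReal.toReal_mono h1 hp
  have hcont : Continuous fun t =>
      ∑ j ∈ Finset.range (4 ^ M), (κ.completion M j t).im • f j := by fun_prop
  have e1 : ∀ j', ∑ j ∈ Finset.range (4 ^ M), κ.cross M j' j • f j = (4 : ℝ) ^ M •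
      ∫ t, κ.weight M j' t • ∑ j ∈ Finset.range (4 ^ M), (κ.completion M j t).im • f j
        ∂circleProb := fun j' => by
    simp_rw [Finset.smul_sum, smul_smul]
    rw [integral_finsetSum _ fun j _ => integrable_circleProb_of_continuous (by fun_prop),
      Finset.smul_sum]
    refine Finset.sum_congr rfl fun j _ => ?_
    rw [integral_smul_const, smul_smul, QuadrantKernel.cross]
  have e2 : ∀ t, ∑ j ∈ Finset.range (4 ^ M), κ.weight M j t • f j =
      (∑ j ∈ Finset.range (4 ^ M), ((1 / 4 : ℝ) ^ M) • f j) +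
        ∑ j ∈ Finset.range (4 ^ M), (κ.completion M j t).re • f j := fun t => by
    rw [← Finset.sum_add_distrib]
    refine Finset.sum_congr rfl fun j _ => ?_
    rw [κ.weight_eq, add_smul]
  have h2 := hK.lintegral_le h0 h1 (m := 4 ^ M) (fun j => κ.completion_mem_analyticModes M j)
    (∑ j ∈ Finset.range (4 ^ M), ((1 / 4 : ℝ) ^ M) • f j) f
  simp_rw [← e2] at h2
  simp_rw [e1]
  calc _ ≤ _ := κ.sum_integral_weight_le hP M hcont
    _ ≤ 4 ^ M * (K ^ p.toReal * _) := by gcongr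
    _ = K ^ p.toReal * (4 ^ M * _) := mul_left_comm _ _ _
    _ ≤ _ := by
      gcongr
      exact κ.lintegral_sum_weight_le hP M f

/-- The bound for `digitShift`, as a limit of the bounds for `cross` divided by `b`; the
constant `4` comes from `17 / 64 ≤ b`. -/
theorem sum_digitShift_le [CompleteSpace X] {p K : ℝ≥0∞}
    (hK : IsHilbertBound X p K) (hp : 1 ≤ p) (h1 : p ≠ ∞)
    (M : ℕ) (f : ℕ → X) :
    ∑ j ∈ Finset.range (4 ^ M), ‖digitShift M f j‖ₑ ^ p.toReal ≤
      (4 * K) ^ p.toReal * ∑ j ∈ Finset.range (4 ^ M), ‖f j‖ₑ ^ p.toReal := by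
  have hη : ∀ n : ℕ, (0 : ℝ) < 1 / ((n : ℝ) + 1) := fun n => by positivity
  have κ : ∀ n : ℕ, QuadrantKernel (1 / ((n : ℝ) + 1)) := fun n =>
    (exists_quadrantKernel (hη n)).some
  have hlim : Tendsto (fun n => ∑ j' ∈ Finset.range (4 ^ M), ‖∑ j ∈ Finset.range (4 ^ M),
      (((κ n).b)⁻¹ * (κ n).cross M j' j) • f j‖ₑ ^ p.toReal) atTop
      (𝓝 (∑ j ∈ Finset.range (4 ^ M), ‖digitShift M f j‖ₑ ^ p.toReal)) := by
    refine tendsto_finsetSum _ fun j' hj' => ?_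
    rw [← sum_shiftMatrix M f (Finset.mem_range.1 hj')]
    refine (ENNReal.continuous_rpow_const.tendsto _).comp ((continuous_enorm.tendsto _).comp ?_)
    exact tendsto_finsetSum _ fun j hj => (tendsto_cross tendsto_one_div_add_atTop_nhds_zero_nat κ
      M (Finset.mem_range.1 hj') (Finset.mem_range.1 hj)).smul_const _
  refine le_of_tendsto' hlim fun n => ?_
  have hb : 0 ≤ ((κ n).b)⁻¹ := inv_nonneg.2 (by linarith [(κ n).lower])
  have hb4 : ENNReal.ofReal ((κ n).b)⁻¹ ≤ 4 := by
    rw [show (4 : ℝ≥0∞) = ENNReal.ofReal 4 by norm_num]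
    refine ENNReal.ofReal_le_ofReal ?_
    rw [show (4 : ℝ) = (1 / 4)⁻¹ by norm_num]
    exact inv_anti₀ (by norm_num) (by linarith [(κ n).lower])
  simp_rw [mul_smul, ← Finset.smul_sum, enorm_smul_of_nonneg hb,
    ENNReal.mul_rpow_of_nonneg _ _ (ENNReal.toReal_nonneg (a := p)), ← Finset.mul_sum]
  rw [mul_assoc]
  gcongr
  exact (κ n).sum_cross_le hK hp h1 M f

/-- `digitShift M` involves only the last `M` digits. -/
theorem digitShift_add (M k : ℕ) (f : ℕ → X) (j : ℕ) :
    digitShift M f (j + k * 4 ^ M) = digitShift M (fun i => f (i + k * 4 ^ M)) j := by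
  induction M generalizing f j with
  | zero => rfl
  | succ M ih =>
    have hk : k * 4 ^ (M + 1) = 4 * (k * 4 ^ M) := by ring
    have hd : (j + k * 4 ^ (M + 1)) / 4 = j / 4 + k * 4 ^ M := by
      rw [hk]; omega
    have hm : (j + k * 4 ^ (M + 1)) % 4 = j % 4 := by
      rw [hk]; omega
    have hs : ∀ i r, 4 * (i + k * 4 ^ M) + r = 4 * i + r + k * 4 ^ (M + 1) := fun i r => by
      rw [pow_succ]; ring
    rw [digitShift, digitShift, hd, ih, localShift, localShift, hm, hd]
    simp_rw [hs]
    congr 2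
    ext i
    simp_rw [blockAvg, hs]

/-- The bound for `digitShift` on several copies of the unit interval. -/
theorem sum_digitShift_mul_le [CompleteSpace X] {p K : ℝ≥0∞}
    (hK : IsHilbertBound X p K) (hp : 1 ≤ p) (h1 : p ≠ ∞)
    (M l : ℕ) (f : ℕ → X) :
    ∑ j ∈ Finset.range (l * 4 ^ M), ‖digitShift M f j‖ₑ ^ p.toReal ≤
      (4 * K) ^ p.toReal * ∑ j ∈ Finset.range (l * 4 ^ M), ‖f j‖ₑ ^ p.toReal := by
  induction l with
  | zero => simp
  | succ l ih =>
    rw [add_mul, one_mul, Finset.sum_range_add, Finset.sum_range_add, mul_add]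
    refine add_le_add ih ?_
    simp_rw [add_comm (l * 4 ^ M), digitShift_add]
    exact sum_digitShift_le hK hp h1 M fun i => f (i + l * 4 ^ M)

/-! ### Transfer to the unit interval -/

/-- The index of the dyadic interval of level `D` which contains `x`. -/
noncomputable def dyadicIdx (D : ℕ) (x : ℝ) : ℕ := ⌊(2 : ℝ) ^ D * x⌋₊

theorem measurable_dyadicIdx (D : ℕ) : Measurable (dyadicIdx D) :=
  Nat.measurable_floor.comp (measurable_const_mul _)

theorem mem_dyadicInterval_iff {D j : ℕ} {x : ℝ} (hx : 0 ≤ x) :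
    x ∈ dyadicInterval D j ↔ dyadicIdx D x = j := by
  have h2 : (0 : ℝ) < 2 ^ D := by positivity
  rw [dyadicIdx, Nat.floor_eq_iff (by positivity), dyadicInterval, Set.mem_Ico, div_le_iff₀' h2,
    lt_div_iff₀' h2]

theorem dyadicIdx_div_pow (D s : ℕ) (x : ℝ) : dyadicIdx (D + s) x / 2 ^ s = dyadicIdx D x := by
  rw [dyadicIdx, dyadicIdx, ← Nat.floor_div_natCast]
  congr 1
  push_cast
  rw [pow_add]
  field_simp

theorem dyadicIdx_lt (D : ℕ) {x : ℝ} (hx : x ∈ Set.Ico (0 : ℝ) 1) : dyadicIdx D x < 2 ^ D := by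
  have h2 : (0 : ℝ) < 2 ^ D := by positivity
  rw [dyadicIdx, Nat.floor_lt (mul_nonneg h2.le hx.1)]
  push_cast
  nlinarith [hx.2]

theorem measurableSet_dyadicInterval (D j : ℕ) : MeasurableSet (dyadicInterval D j) :=
  measurableSet_Ico

theorem nonneg_of_mem_dyadicInterval {D j : ℕ} {x : ℝ} (hx : x ∈ dyadicInterval D j) : 0 ≤ x :=
  le_trans (by positivity) hx.1

theorem dyadicInterval_subset {D j : ℕ} (hj : j < 2 ^ D) :
    dyadicInterval D j ⊆ Set.Ico (0 : ℝ) 1 := fun x hx => by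
  refine ⟨nonneg_of_mem_dyadicInterval hx, hx.2.trans_le ?_⟩
  rw [div_le_one (by positivity)]
  exact_mod_cast hj

theorem disjoint_dyadicInterval {D j j' : ℕ} (h : j ≠ j') :
    Disjoint (dyadicInterval D j) (dyadicInterval D j') := by
  refine Set.disjoint_left.2 fun x hx hx' => h ?_
  have h0 := nonneg_of_mem_dyadicInterval hx
  rw [← (mem_dyadicInterval_iff h0).1 hx, (mem_dyadicInterval_iff h0).1 hx']

theorem dyadicInterval_union (D j : ℕ) :
    dyadicInterval (D + 1) (2 * j) ∪ dyadicInterval (D + 1) (2 * j + 1) = dyadicInterval D j := by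
  ext x
  have key : 0 ≤ x → (x ∈ dyadicInterval (D + 1) (2 * j) ∪ dyadicInterval (D + 1) (2 * j + 1) ↔
      x ∈ dyadicInterval D j) := fun h0 => by
    rw [Set.mem_union, mem_dyadicInterval_iff h0, mem_dyadicInterval_iff h0,
      mem_dyadicInterval_iff h0, ← dyadicIdx_div_pow D 1]
    omega
  constructor
  · intro h
    exact (key (h.elim nonneg_of_mem_dyadicInterval nonneg_of_mem_dyadicInterval)).1 h
  · intro h
    exact (key (nonneg_of_mem_dyadicInterval h)).2 h

theorem biUnion_dyadicInterval (D : ℕ) :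
    ⋃ j ∈ Finset.range (2 ^ D), dyadicInterval D j = Set.Ico (0 : ℝ) 1 := by
  ext x
  simp only [Set.mem_iUnion, Finset.mem_range, exists_prop]
  constructor
  · rintro ⟨j, hj, hx⟩
    exact dyadicInterval_subset hj hx
  · intro hx
    exact ⟨_, dyadicIdx_lt D hx, (mem_dyadicInterval_iff hx.1).2 rfl⟩

theorem unitMeasure_dyadicInterval {D j : ℕ} (hj : j < 2 ^ D) :
    unitMeasure (dyadicInterval D j) = (2 ^ D)⁻¹ := by
  rw [unitMeasure, Measure.restrict_apply (measurableSet_dyadicInterval D j),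
    Set.inter_eq_left.2 (dyadicInterval_subset hj), dyadicInterval, Real.volume_Ico,
    show ((j : ℝ) + 1) / 2 ^ D - j / 2 ^ D = (2 ^ D)⁻¹ by ring,
    ENNReal.ofReal_inv_of_pos (by positivity), ENNReal.ofReal_pow (by norm_num)]
  norm_num

instance : IsProbabilityMeasure unitMeasure := ⟨by simp [unitMeasure]⟩

theorem lintegral_unitMeasure_eq_sum (D : ℕ) (F : ℝ → ℝ≥0∞) :
    ∫⁻ x, F x ∂unitMeasure =
      ∑ j ∈ Finset.range (2 ^ D), ∫⁻ x in dyadicInterval D j, F x ∂unitMeasure := by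
  rw [← lintegral_biUnion_finset (fun _ _ _ _ h => disjoint_dyadicInterval h)
    fun j _ => measurableSet_dyadicInterval D j, biUnion_dyadicInterval, unitMeasure,
    Measure.restrict_restrict measurableSet_Ico, Set.inter_self]

theorem lintegral_dyadicIdx (D : ℕ) (φ : ℕ → ℝ≥0∞) :
    ∫⁻ x, φ (dyadicIdx D x) ∂unitMeasure = ∑ j ∈ Finset.range (2 ^ D), (2 ^ D)⁻¹ * φ j := by
  rw [lintegral_unitMeasure_eq_sum D]
  refine Finset.sum_congr rfl fun j hj => ?_
  rw [setLIntegral_congr_fun (g := fun _ => φ j) (measurableSet_dyadicInterval D j) fun x hx => by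
      simp only [(mem_dyadicInterval_iff (nonneg_of_mem_dyadicInterval hx)).1 hx],
    setLIntegral_const, unitMeasure_dyadicInterval (Finset.mem_range.1 hj), mul_comm]

/-- The average of `f` over a dyadic interval of level `D` in the unit interval. -/
noncomputable def dyadicAvg (f : ℝ → X) (D j : ℕ) : X :=
  (2 : ℝ) ^ D • ∫ x in dyadicInterval D j, f x ∂unitMeasure

theorem dyadicAvg_eq {f : ℝ → X} (hf : Integrable f unitMeasure) (D j : ℕ) :
    dyadicAvg f D j =
      (1 / 2 : ℝ) • (dyadicAvg f (D + 1) (2 * j) + dyadicAvg f (D + 1) (2 * j + 1)) := by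
  rw [dyadicAvg, ← dyadicInterval_union, setIntegral_union (disjoint_dyadicInterval (by omega))
    (measurableSet_dyadicInterval _ _) hf.integrableOn hf.integrableOn, dyadicAvg, dyadicAvg,
    ← smul_add, smul_smul, pow_succ]
  congr 1
  ring

theorem blockAvg_dyadicAvg {f : ℝ → X} (hf : Integrable f unitMeasure) (D : ℕ) :
    blockAvg (dyadicAvg f (D + 2)) = dyadicAvg f D := by
  ext i
  rw [dyadicAvg_eq hf D i, dyadicAvg_eq hf (D + 1), dyadicAvg_eq hf (D + 1), blockAvg]
  simp only [Finset.sum_range_succ, Finset.sum_range_zero, zero_add, add_zero]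
  rw [show 2 * (2 * i) = 4 * i by ring, show 2 * (2 * i + 1) = 4 * i + 2 by ring]
  module

theorem sum_dyadicAvg_le {f : ℝ → X} (hf : AEStronglyMeasurable f unitMeasure) {P : ℝ} (hP : 1 ≤ P)
    (D : ℕ) : ∑ j ∈ Finset.range (2 ^ D), (2 ^ D)⁻¹ * ‖dyadicAvg f D j‖ₑ ^ P ≤
      ∫⁻ x, ‖f x‖ₑ ^ P ∂unitMeasure := by
  rw [lintegral_unitMeasure_eq_sum D]
  refine Finset.sum_le_sum fun j hj => ?_
  have h2 : ENNReal.ofReal (2 ^ D) = 2 ^ D := by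
    rw [ENNReal.ofReal_pow (by norm_num)]; norm_num
  have h20 : (2 : ℝ≥0∞) ^ D ≠ 0 := by simp
  have h2t : (2 : ℝ≥0∞) ^ D ≠ ∞ := by simp
  have h1 := lintegral_mul_rpow_le (μ := unitMeasure.restrict (dyadicInterval D j))
    (W := fun _ => 2 ^ D) (h := fun x => ‖f x‖ₑ) measurable_const hf.restrict.enorm ?_ hP
  · rw [lintegral_const_mul' _ _ h2t, lintegral_const_mul' _ _ h2t] at h1
    calc _ ≤ (2 ^ D)⁻¹ * (2 ^ D * ∫⁻ x in dyadicInterval D j, ‖f x‖ₑ ^ P ∂unitMeasure) := by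
          gcongr
          refine le_trans (ENNReal.rpow_le_rpow ?_ (by linarith)) h1
          rw [dyadicAvg, enorm_smul_of_nonneg (by positivity), h2]
          gcongr
          exact enorm_integral_le_lintegral_enorm _
      _ = _ := by rw [← mul_assoc, ENNReal.inv_mul_cancel h20 h2t, one_mul]
  · rw [setLIntegral_const, unitMeasure_dyadicInterval (Finset.mem_range.1 hj),
      ENNReal.mul_inv_cancel h20 h2t]

theorem haar_smul_eq (f : ℝ → X) (k l : ℕ) (x : ℝ) : haar k l x • f x =
    Real.sqrt (2 ^ k) • ((dyadicInterval (k + 1) (2 * l + 1)).indicator f x -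
      (dyadicInterval (k + 1) (2 * l)).indicator f x) := by
  rw [haar, mul_smul, sub_smul]
  congr 2 <;> simp only [Set.indicator] <;> split_ifs <;> simp

theorem haarCoeff_eq {f : ℝ → X} (hf : Integrable f unitMeasure) (k l : ℕ) : haarCoeff f k l =
    (Real.sqrt (2 ^ k) * (2 ^ (k + 1))⁻¹) •
      (dyadicAvg f (k + 1) (2 * l + 1) - dyadicAvg f (k + 1) (2 * l)) := by
  rw [haarCoeff]
  simp_rw [haar_smul_eq]
  rw [integral_smul, integral_sub (hf.indicator (measurableSet_dyadicInterval _ _))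
    (hf.indicator (measurableSet_dyadicInterval _ _)),
    integral_indicator (measurableSet_dyadicInterval _ _),
    integral_indicator (measurableSet_dyadicInterval _ _), dyadicAvg, dyadicAvg, ← smul_sub,
    smul_smul, mul_assoc, inv_mul_cancel₀ (by positivity), mul_one]

theorem haar_eq (k l : ℕ) {x : ℝ} (hx : 0 ≤ x) : haar k l x =
    if dyadicIdx (k + 1) x / 2 = l then
      Real.sqrt (2 ^ k) * secondSign (dyadicIdx (k + 1) x) else 0 := by
  simp only [haar, Set.indicator, mem_dyadicInterval_iff hx]
  generalize dyadicIdx (k + 1) x = m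
  rw [secondSign]
  by_cases h1 : m = 2 * l
  · subst h1
    simp
  · by_cases h2 : m = 2 * l + 1
    · subst h2
      have : (2 * l + 1) / 2 = l := by omega
      simp [this]
    · have : m / 2 ≠ l := by omega
      simp [h1, h2, this]

/-- One level of the dyadic Hilbert transform, as an operator on averages. -/
theorem shift_level_eq {f : ℝ → X} (hf : Integrable f unitMeasure) (k : ℕ) {x : ℝ}
    (hx : x ∈ Set.Ico (0 : ℝ) 1) :
    ∑ j ∈ Finset.range (2 ^ k), (haar (k + 1) (2 * j) x • haarCoeff f (k + 1) (2 * j + 1) -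
      haar (k + 1) (2 * j + 1) x • haarCoeff f (k + 1) (2 * j)) =
      localShift (dyadicAvg f (k + 2)) (dyadicIdx (k + 2) x) := by
  have hlt := dyadicIdx_lt (k + 2) hx
  have hs : Real.sqrt (2 ^ (k + 1)) * (Real.sqrt (2 ^ (k + 1)) * (2 ^ (k + 1 + 1))⁻¹) = 1 / 2 := by
    rw [← mul_assoc, Real.mul_self_sqrt (by positivity), pow_succ (2 : ℝ) (k + 1)]
    field_simp
  simp only [haar_eq _ _ hx.1, haarCoeff_eq hf, show k + 1 + 1 = k + 2 from rfl] at *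
  generalize dyadicIdx (k + 2) x = m at *
  generalize Real.sqrt (2 ^ (k + 1)) = s at *
  generalize dyadicAvg f (k + 2) = A
  generalize ((2 : ℝ) ^ (k + 2))⁻¹ = c at *
  rw [Finset.sum_eq_single (m / 4)]
  · obtain ⟨i, r, hr, rfl⟩ : ∃ i r, r < 4 ∧ m = 4 * i + r := ⟨m / 4, m % 4, by omega, by omega⟩
    obtain ⟨v0, v1, v2, v3, w0, w1, w2, w3⟩ := sign_values
    have hsec : secondSign (4 * i + r) = secondSign r := by
      rw [secondSign, secondSign, show (4 * i + r) % 2 = r % 2 by omega]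
    rw [four_mul_add_div hr, localShift, four_mul_add_mod hr, four_mul_add_div hr, hsec]
    have e1 : 2 * (2 * i) = 4 * i := by ring
    have e2 : 2 * (2 * i + 1) = 4 * i + 2 := by ring
    simp only [Finset.sum_range_succ, Finset.sum_range_zero, e1, e2, blockShift, zero_add]
    have hcases : ((4 * i + r) / 2 = 2 * i ∧ (r = 0 ∨ r = 1)) ∨
        ((4 * i + r) / 2 = 2 * i + 1 ∧ (r = 2 ∨ r = 3)) := by omega
    rcases hcases with ⟨h, rfl | rfl⟩ | ⟨h, rfl | rfl⟩ <;>
      simp only [h, v0, v1, v2, v3, w0, w1, w2, w3, if_true, Nat.left_eq_add, Nat.add_eq_left,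
        one_ne_zero, if_false, smul_smul] <;>
      rw [show ∀ a : ℝ, s * a * (s * c) = a * (1 / 2) from fun a => by rw [← hs]; ring] <;> module
  · intro j _ hj
    rw [if_neg (by omega), if_neg (by omega)]
    simp
  · intro h
    exfalso
    rw [Finset.mem_range, not_lt] at h
    rw [pow_add] at hlt
    omega

/-- The operator `digitShift` on averages is the sum of every second level. -/
theorem digitShift_dyadicAvg {f : ℝ → X} (hf : Integrable f unitMeasure) (e M : ℕ) (x : ℝ) :
    digitShift M (dyadicAvg f (2 * M + e)) (dyadicIdx (2 * M + e) x) = ∑ m ∈ Finset.range M,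
      localShift (dyadicAvg f (2 * m + e + 2)) (dyadicIdx (2 * m + e + 2) x) := by
  induction M with
  | zero => simp [digitShift]
  | succ M ih =>
    rw [Finset.sum_range_succ, ← ih, digitShift, show 2 * (M + 1) + e = 2 * M + e + 2 by ring,
      blockAvg_dyadicAvg hf, ← dyadicIdx_div_pow (2 * M + e) 2]
    rfl

theorem sum_range_even_add_odd {A : Type*} [AddCommMonoid A] (F : ℕ → A) (N : ℕ) :
    ∑ k ∈ Finset.range N, F k = ∑ m ∈ Finset.range ((N + 1) / 2), F (2 * m) +
      ∑ m ∈ Finset.range (N / 2), F (2 * m + 1) := by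
  induction N with
  | zero => simp
  | succ N ih =>
    rw [Finset.sum_range_succ, ih]
    rcases Nat.even_or_odd' N with ⟨n, rfl | rfl⟩
    · rw [show (2 * n + 1 + 1) / 2 = n + 1 by omega, show (2 * n + 1) / 2 = n by omega,
        show 2 * n / 2 = n by omega, Finset.sum_range_succ]
      abel
    · rw [show (2 * n + 1 + 1 + 1) / 2 = n + 1 by omega, show (2 * n + 1 + 1) / 2 = n + 1 by omega,
        show (2 * n + 1) / 2 = n by omega, Finset.sum_range_succ _ n,
        Finset.sum_range_succ (fun m => F (2 * m + 1))]
      abel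

/-- The levels of one parity of the dyadic Hilbert transform form a `digitShift`. For the odd levels
the first binary digit is left over, and the base-`4` digits start after it. -/
theorem shiftPartial_eq {f : ℝ → X} (hf : Integrable f unitMeasure) (N : ℕ) {x : ℝ}
    (hx : x ∈ Set.Ico (0 : ℝ) 1) : shiftPartial f N x =
      digitShift ((N + 1) / 2) (dyadicAvg f (2 * ((N + 1) / 2) + 0))
          (dyadicIdx (2 * ((N + 1) / 2) + 0) x) +
        digitShift (N / 2) (dyadicAvg f (2 * (N / 2) + 1)) (dyadicIdx (2 * (N / 2) + 1) x) := by
  rw [shiftPartial, digitShift_dyadicAvg hf, digitShift_dyadicAvg hf]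
  simp_rw [shift_level_eq hf _ hx]
  exact sum_range_even_add_odd _ N

theorem ae_mem_unitInterval : ∀ᵐ x ∂unitMeasure, x ∈ Set.Ico (0 : ℝ) 1 :=
  ae_restrict_mem measurableSet_Ico

theorem aestronglyMeasurable_dyadicIdx {E : Type*} [NormedAddCommGroup E] (D : ℕ) (φ : ℕ → E) :
    AEStronglyMeasurable (fun x => φ (dyadicIdx D x)) unitMeasure :=
  ((StronglyMeasurable.of_discrete (f := φ)).comp_measurable
    (measurable_dyadicIdx D)).aestronglyMeasurable

theorem eLpNorm_digitShift_le [CompleteSpace X] {p K : ℝ≥0∞} (hK : IsHilbertBound X p K)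
    (hp : 1 ≤ p) (h1 : p ≠ ∞) {f : ℝ → X} (hf : AEStronglyMeasurable f unitMeasure) (M e : ℕ) :
    eLpNorm (fun x => digitShift M (dyadicAvg f (2 * M + e)) (dyadicIdx (2 * M + e) x)) p
      unitMeasure ≤ 4 * K * eLpNorm f p unitMeasure := by
  have h0 : p ≠ 0 := (zero_lt_one.trans_le hp).ne'
  have hP : 1 ≤ p.toReal := by
    rw [← ENNReal.toReal_one]
    exact ENNReal.toReal_mono h1 hp
  have hP0 : 0 < p.toReal := by linarith
  rw [← ENNReal.rpow_le_rpow_iff hP0, ENNReal.mul_rpow_of_nonneg _ _ hP0.le,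
    eLpNorm_rpow_toReal _ h0 h1, eLpNorm_rpow_toReal _ h0 h1, lintegral_dyadicIdx (2 * M + e)
      fun j => ‖digitShift M (dyadicAvg f (2 * M + e)) j‖ₑ ^ p.toReal, ← Finset.mul_sum]
  have hpow : 2 ^ (2 * M + e) = 2 ^ e * 4 ^ M := by
    rw [pow_add, pow_mul, mul_comm]
    norm_num
  have key := sum_digitShift_mul_le hK hp h1 M (2 ^ e) (dyadicAvg f (2 * M + e))
  rw [← hpow] at key
  calc _ ≤ ((2 : ℝ≥0∞) ^ (2 * M + e))⁻¹ * ((4 * K) ^ p.toReal *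
        ∑ j ∈ Finset.range (2 ^ (2 * M + e)), ‖dyadicAvg f (2 * M + e) j‖ₑ ^ p.toReal) :=
        mul_le_mul_right key _
    _ = (4 * K) ^ p.toReal * ∑ j ∈ Finset.range (2 ^ (2 * M + e)), (2 ^ (2 * M + e))⁻¹ *
        ‖dyadicAvg f (2 * M + e) j‖ₑ ^ p.toReal := by
        rw [← Finset.mul_sum, mul_left_comm]
    _ ≤ _ := by
        gcongr
        exact sum_dyadicAvg_le hf hP _

theorem shiftPartial_ae_eq {f : ℝ → X} (hf : Integrable f unitMeasure) (N : ℕ) :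
    shiftPartial f N =ᵐ[unitMeasure] fun x =>
      digitShift ((N + 1) / 2) (dyadicAvg f (2 * ((N + 1) / 2) + 0))
          (dyadicIdx (2 * ((N + 1) / 2) + 0) x) +
        digitShift (N / 2) (dyadicAvg f (2 * (N / 2) + 1)) (dyadicIdx (2 * (N / 2) + 1) x) :=
  ae_mem_unitInterval.mono fun _ hx => shiftPartial_eq hf N hx

theorem aestronglyMeasurable_shiftPartial {f : ℝ → X} (hf : Integrable f unitMeasure) (N : ℕ) :
    AEStronglyMeasurable (shiftPartial f N) unitMeasure :=
  ((aestronglyMeasurable_dyadicIdx _ _).add (aestronglyMeasurable_dyadicIdx _ _)).congr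
    (shiftPartial_ae_eq hf N).symm

/-- The partial sums of the dyadic Hilbert transform are uniformly bounded. -/
theorem eLpNorm_shiftPartial_le [CompleteSpace X] {p K : ℝ≥0∞} (hK : IsHilbertBound X p K)
    (hp : 1 ≤ p) (h1 : p ≠ ∞) {f : ℝ → X} (hf : Integrable f unitMeasure) (N : ℕ) :
    eLpNorm (shiftPartial f N) p unitMeasure ≤ 8 * K * eLpNorm f p unitMeasure := by
  rw [eLpNorm_congr_ae (shiftPartial_ae_eq hf N)]
  refine (eLpNorm_add_le (aestronglyMeasurable_dyadicIdx _ _)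
    (aestronglyMeasurable_dyadicIdx _ _) hp).trans ?_
  refine (add_le_add (eLpNorm_digitShift_le hK hp h1 hf.aestronglyMeasurable _ _)
    (eLpNorm_digitShift_le hK hp h1 hf.aestronglyMeasurable _ _)).trans_eq ?_
  ring

theorem haarCoeff_sub {f h : ℝ → X} (hf : Integrable f unitMeasure) (hh : Integrable h unitMeasure)
    (k l : ℕ) : haarCoeff (f - h) k l = haarCoeff f k l - haarCoeff h k l := by
  have e : ∀ D j, dyadicAvg (f - h) D j = dyadicAvg f D j - dyadicAvg h D j := fun D j => by
    simp only [dyadicAvg, Pi.sub_apply]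
    rw [integral_sub hf.integrableOn hh.integrableOn, smul_sub]
  rw [haarCoeff_eq hf, haarCoeff_eq hh, haarCoeff_eq (hf.sub hh), e, e]
  module

theorem shiftPartial_sub {f h : ℝ → X} (hf : Integrable f unitMeasure)
    (hh : Integrable h unitMeasure) (N : ℕ) :
    shiftPartial (f - h) N = shiftPartial f N - shiftPartial h N := by
  ext x
  simp only [shiftPartial, haarCoeff_sub hf hh, Pi.sub_apply, ← Finset.sum_sub_distrib]
  refine Finset.sum_congr rfl fun k _ => Finset.sum_congr rfl fun j _ => ?_
  module

theorem dyadicAvg_step [CompleteSpace X] (D s : ℕ) (φ : ℕ → X) {j : ℕ} (hj : j < 2 ^ (D + s)) :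
    dyadicAvg (fun x => φ (dyadicIdx D x)) (D + s) j = φ (j / 2 ^ s) := by
  rw [dyadicAvg, setIntegral_congr_fun (g := fun _ => φ (j / 2 ^ s))
    (measurableSet_dyadicInterval _ _) fun x hx => by
      simp only [← dyadicIdx_div_pow D s x,
        (mem_dyadicInterval_iff (nonneg_of_mem_dyadicInterval hx)).1 hx],
    setIntegral_const, measureReal_def, unitMeasure_dyadicInterval hj, smul_smul]
  simp

theorem integrable_step {E : Type*} [NormedAddCommGroup E] (D : ℕ) (φ : ℕ → E) :
    Integrable (fun x => φ (dyadicIdx D x)) unitMeasure := by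
  refine ⟨aestronglyMeasurable_dyadicIdx D φ, ?_⟩
  rw [HasFiniteIntegral, lintegral_dyadicIdx D fun j => ‖φ j‖ₑ]
  exact ENNReal.sum_lt_top.2 fun j _ =>
    ENNReal.mul_lt_top (ENNReal.inv_lt_top.2 (by positivity)) enorm_lt_top

/-- On dyadic step functions the expansion of the dyadic Hilbert transform is finite. -/
theorem shiftPartial_step [CompleteSpace X] (D : ℕ) (φ : ℕ → X) {N : ℕ} (hN : D ≤ N) :
    shiftPartial (fun x => φ (dyadicIdx D x)) N = shiftPartial (fun x => φ (dyadicIdx D x)) D := by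
  have hz : ∀ k ≥ D, ∀ l < 2 ^ k, haarCoeff (fun x => φ (dyadicIdx D x)) k l = 0 := by
    intro k hk l hl
    obtain ⟨s, rfl⟩ := Nat.exists_eq_add_of_le hk
    rw [haarCoeff_eq (integrable_step D φ), add_assoc,
      dyadicAvg_step D (s + 1) φ (by rw [← add_assoc, pow_succ]; omega),
      dyadicAvg_step D (s + 1) φ (by rw [← add_assoc, pow_succ]; omega), pow_succ',
      ← Nat.div_div_eq_div_mul, ← Nat.div_div_eq_div_mul, show (2 * l + 1) / 2 = l by omega,
      show 2 * l / 2 = l by omega, sub_self, smul_zero]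
  ext x
  rw [shiftPartial, shiftPartial]
  symm
  refine Finset.sum_subset (Finset.range_mono hN) fun k _ hk => Finset.sum_eq_zero fun j hj => ?_
  have hk' : D ≤ k := by simpa using hk
  have hj' := Finset.mem_range.1 hj
  rw [hz (k + 1) (by omega) _ (by rw [pow_succ]; omega),
    hz (k + 1) (by omega) _ (by rw [pow_succ]; omega)]
  simp

/-- Dyadic step functions are dense. -/
theorem exists_step_eLpNorm_sub_le {p : ℝ≥0∞} (hp : 1 ≤ p) (h1 : p ≠ ∞) {f : ℝ → X}
    (hf : MemLp f p unitMeasure) {ε : ℝ≥0} (hε : 0 < ε) :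
    ∃ (D : ℕ) (φ : ℕ → X), eLpNorm (f - fun x => φ (dyadicIdx D x)) p unitMeasure ≤ ε := by
  have hε2 : (0 : ℝ) < ε / 2 := by positivity
  obtain ⟨g, hgs, hfg, hgc, hg⟩ := hf.exists_hasCompactSupport_eLpNorm_sub_le h1
    (ε := ((ε / 2 : ℝ≥0) : ℝ≥0∞)) (by simpa using hε.ne')
  obtain ⟨δ, hδ, hgδ⟩ := Metric.uniformContinuous_iff.1 (hgs.uniformContinuous_of_continuous hgc)
    (ε / 2) hε2
  obtain ⟨D, hD⟩ := exists_pow_lt_of_lt_one hδ (by norm_num : (1 / 2 : ℝ) < 1)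
  refine ⟨D, fun j => g (j / 2 ^ D), ?_⟩
  have hstep : eLpNorm (g - fun x => g (dyadicIdx D x / 2 ^ D)) p unitMeasure ≤
      ((ε / 2 : ℝ≥0) : ℝ≥0∞) := by
    have h := eLpNorm_le_of_ae_bound (p := p) (μ := unitMeasure) (C := (ε : ℝ) / 2)
      (f := g - fun x => g (dyadicIdx D x / 2 ^ D)) (ae_mem_unitInterval.mono fun x hx => ?_)
    · refine h.trans_eq ?_
      rw [measure_univ, ENNReal.one_rpow, one_mul,
        show (ε : ℝ) / 2 = ((ε / 2 : ℝ≥0) : ℝ) by push_cast; rfl, ENNReal.ofReal_coe_nnreal]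
    · rw [Pi.sub_apply, ← dist_eq_norm]
      refine (hgδ ?_).le
      have hm := (mem_dyadicInterval_iff (D := D) hx.1).2 rfl
      have h3 := hm.1
      have h4 := hm.2
      rw [add_div] at h4
      rw [Real.dist_eq, abs_of_nonneg (sub_nonneg.2 h3)]
      refine lt_of_le_of_lt ?_ hD
      rw [one_div, inv_pow, ← one_div]
      linarith
  calc _ = eLpNorm ((f - g) + (g - fun x => g (dyadicIdx D x / 2 ^ D))) p unitMeasure := by
        rw [sub_add_sub_cancel]
    _ ≤ _ := eLpNorm_add_le (hf.1.sub hg.1)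
        (hg.1.sub (aestronglyMeasurable_dyadicIdx D fun j => g (j / 2 ^ D))) hp
    _ ≤ ((ε / 2 : ℝ≥0) : ℝ≥0∞) + ((ε / 2 : ℝ≥0) : ℝ≥0∞) := add_le_add hfg hstep
    _ = ε := by rw [← ENNReal.coe_add, add_halves]

/-- The partial sums form a Cauchy sequence: up to a small error in `f` they are eventually
constant. -/
theorem exists_isShift [CompleteSpace X] {p K : ℝ≥0∞} (hK : IsHilbertBound X p K) (hKt : K ≠ ∞)
    (hp : 1 ≤ p) (h1 : p ≠ ∞) {f : ℝ → X} (hf : MemLp f p unitMeasure) :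
    ∃ g : ℝ → X, MemLp g p unitMeasure ∧ IsShift p f g ∧
      eLpNorm g p unitMeasure ≤ 8 * K * eLpNorm f p unitMeasure := by
  have : Fact (1 ≤ p) := ⟨hp⟩
  have hfi : Integrable f unitMeasure := hf.integrable hp
  have hSm : ∀ N, MemLp (shiftPartial f N) p unitMeasure := fun N =>
    ⟨aestronglyMeasurable_shiftPartial hfi N, (eLpNorm_shiftPartial_le hK hp h1 hfi N).trans_lt
      (ENNReal.mul_lt_top (ENNReal.mul_lt_top (by simp) hKt.lt_top) hf.2)⟩
  have hcauchy : CauchySeq fun N => (hSm N).toLp (shiftPartial f N) := by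
    refine EMetric.cauchySeq_iff.2 fun ε hε => ?_
    obtain ⟨δ, hδ, hδε⟩ : ∃ δ : ℝ≥0, 0 < δ ∧ 8 * K * δ + 8 * K * δ < ε := by
      have hlim : Tendsto (fun δ : ℝ≥0 => 8 * K * (δ : ℝ≥0∞) + 8 * K * (δ : ℝ≥0∞)) (𝓝 0)
          (𝓝 0) := by
        have hc : Tendsto (fun δ : ℝ≥0 => 8 * K * (δ : ℝ≥0∞)) (𝓝 0) (𝓝 (8 * K * 0)) :=
          ENNReal.Tendsto.const_mul (by exact_mod_cast ENNReal.continuous_coe.tendsto 0)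
            (Or.inr (ENNReal.mul_ne_top (by simp) hKt))
        simpa using hc.add hc
      have := (hlim.mono_left (nhdsWithin_le_nhds (s := Set.Ioi 0))).eventually (gt_mem_nhds hε)
      obtain ⟨δ, h, hpos⟩ := (this.and self_mem_nhdsWithin).exists
      exact ⟨δ, hpos, h⟩
    obtain ⟨D, φ, hφ⟩ := exists_step_eLpNorm_sub_le hp h1 hf hδ
    have hh := integrable_step D φ
    refine ⟨D, fun m hm n hn => ?_⟩
    rw [Lp.edist_toLp_toLp]
    have e : shiftPartial f m - shiftPartial f n =
        shiftPartial (f - fun x => φ (dyadicIdx D x)) m -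
          shiftPartial (f - fun x => φ (dyadicIdx D x)) n := by
      rw [shiftPartial_sub hfi hh, shiftPartial_sub hfi hh, shiftPartial_step D φ hm,
        shiftPartial_step D φ hn, sub_sub_sub_cancel_right]
    rw [e]
    refine lt_of_le_of_lt ?_ hδε
    refine (eLpNorm_sub_le (aestronglyMeasurable_shiftPartial (hfi.sub hh) m)
      (aestronglyMeasurable_shiftPartial (hfi.sub hh) n) hp).trans (add_le_add ?_ ?_) <;>
    · refine (eLpNorm_shiftPartial_le hK hp h1 (hfi.sub hh) _).trans ?_
      gcongr
  obtain ⟨G, hG⟩ := cauchySeq_tendsto_of_complete hcauchy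
  have hGm : MemLp G p unitMeasure := Lp.memLp G
  have hshift : Tendsto (fun N => eLpNorm (shiftPartial f N - ⇑G) p unitMeasure) atTop (𝓝 0) := by
    rw [← Lp.tendsto_Lp_iff_tendsto_eLpNorm'' _ hSm _ hGm, Lp.toLp_coeFn]
    exact hG
  refine ⟨G, hGm, hshift, ?_⟩
  have hle : ∀ N, eLpNorm G p unitMeasure ≤
      8 * K * eLpNorm f p unitMeasure + eLpNorm (shiftPartial f N - ⇑G) p unitMeasure := fun N => by
    calc eLpNorm G p unitMeasure
        = eLpNorm (shiftPartial f N - (shiftPartial f N - ⇑G)) p unitMeasure := by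
          rw [sub_sub_cancel]
      _ ≤ _ := eLpNorm_sub_le (hSm N).1 ((hSm N).1.sub hGm.1) hp
      _ ≤ _ := add_le_add (eLpNorm_shiftPartial_le hK hp h1 hfi N) le_rfl
  have hlim := hshift.const_add (8 * K * eLpNorm f p unitMeasure)
  rw [add_zero] at hlim
  exact ge_of_tendsto' hlim hle

end DyadicHilbert

theorem theorem1 :
    ∃ C : ℝ≥0, ∀ (X : Type*) [NormedAddCommGroup X] [NormedSpace ℝ X] [CompleteSpace X]
      (p : ℝ≥0∞), 1 < p → p ≠ ∞ →
        DyadicHilbert.shiftNorm X p ≤ (C : ℝ≥0∞) * DyadicHilbert.hilbertNorm X p := by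
  refine ⟨8, fun X _ _ _ p hp h1 => ?_⟩
  rw [mul_comm, ← ENNReal.div_le_iff_le_mul (Or.inl (by norm_num)) (Or.inl ENNReal.coe_ne_top)]
  refine le_sInf fun K hK => ?_
  rw [ENNReal.div_le_iff_le_mul (Or.inl (by norm_num)) (Or.inl ENNReal.coe_ne_top), mul_comm]
  by_cases hKt : K = ∞
  · rw [hKt, ENNReal.mul_top (by norm_num)]
    exact le_top
  · exact sInf_le fun f hf => DyadicHilbert.exists_isShift hK hKt hp.le h1 hf
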